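/- **Setting.** Let $\mathscr O\subset\mathbb R^d$, $d\in\{1,2,3\}$, be a nonempty bounded open set, $H=L^2(\mathscr O)$ with norm $\|\cdot\|$ and inner product $\langle\cdot,\cdot\rangle$, $\dot H^1=H^1_0(\mathscr O)$, $\dot H^{-1}$ its dual, and let $$\lambda_1=\inf_{0\neq u\in H^1_0(\mathscr O)}\frac{\|\nabla u\|^2}{\|u\|^2}$$ be the first eigenvalue of the Dirichlet Laplacian. Let $\mathbf Q$ be a self-adjoint, positive definite, trace-class operator on $H$ with an orthonormal basis of eigenvectors $(g_k)$ and eigenvalues $q_k>0$, and let $W$ be an $H$-valued $\mathbf Q$-Wiener process on a filtered probability space $(\Omega,\mathscr F,(\mathscr F_t)_{t\ge0},\mathbb P)$. Let $\mathcal L_2^0$ be the space of Hilbert–Schmidt operators from $\mathbf Q^{1/2}H$ to $H$, so that $\|T\|_{\mathcal L_2^0}^2=\sum_k q_k\|Tg_k\|^2$. *Drift.* $f:\mathbb R\to\mathbb R$ is differentiable and, for some $L_1,\dots,L_5\in\mathbb R$ and $q\ge 1$ (with $q\le 3$ if $d=3$), for all $\xi,\eta\in\mathbb R$: $$(f(\xi)-f(\eta))(\xi-\eta)\le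 L_1(\xi-\eta)^2,\qquad f(\xi)\xi\le L_2|\xi|^2+L_3,\qquad |f'(\xi)|\le L_4|\xi|^{q-1}+L_5 .$$ Write $F(x)(\xi)=f(x(\xi))$. *Diffusion.* For $g:\mathbb R\to\mathbb R$, the operator $(G(x)u)(\xi)=g(x(\xi))u(\xi)$ maps $H$ to $\mathcal L_2^0$, and there are $L_6,L_7,L_8\ge0$ such that for all $x,y\in H$ $$\|G(x)-G(y)\|_{\mathcal L_2^0}^2\le L_6\|x-y\|^2,\qquad \|G(x)\|_{\mathcal L_2^0}^2\le L_7\|x\|^2+L_8 .$$ *Scheme.* Let $\tau,h\in(0,1)$ and $t_m=m\tau$. Let $\mathcal T_h$ be a partition of $\overline{\mathscr O}$ into finitely many closed cells with nonempty, pairwise disjoint interiors and diameters at most $h$, and let $V_h\subset\dot H^1$ be the space of continuous functions on $\overline{\mathscr O}$ that are affine on each cell and vanish on $\partial\mathscr O$, with the norm of $H$. Define $A_h:V_h\to V_h$ and $\mathcal P_h:\dot H^{-1}\to V_h$ by $\langle v,A_hx\rangle=-\langle\nabla x,\nabla v\rangle$ and $\langle v,\mathcal P_hz\rangle=z(v)$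 for all $v\in V_h$. For $x\in H$ let $(X_m^{h,x})_{m\in\mathbb N}$ be the $V_h$-valued process, with $X^{h,x}_m$ $\mathscr F_{t_m}$-measurable, given by $X_0^{h,x}=\mathcal P_hx$ and $$X^h_{m+1}=X^h_m+\tau A_hX^h_{m+1}+\tau\mathcal P_hF(X^h_{m+1})+\mathcal P_hG(X^h_m)\big(W(t_{m+1})-W(t_m)\big),\qquad m\in\mathbb N,\tag{DIEG}$$ and set $P^h_m\phi(x)=\mathbb E\,\phi(X^{h,x}_m)$. A probability measure $\mu$ on $V_h$ is invariant if $\int_{V_h}P^h_m\phi\,d\mu=\int_{V_h}\phi\,d\mu$ for all bounded continuous $\phi$ on $V_h$ and all $m\in\mathbb N$. **Theorem.** Assume $\max(L_1+L_6/2,\;L_2+L_7/2)<\lambda_1$. Then for all $\tau,h\in(0,1)$ and every such partition, (DIEG) has for each $x\in H$ a solution, unique up to almost sure equality, and it possesses a unique invariant probability measure $\pi^h_\tau$ on $V_h$. With $$\gamma_6=\frac{2(\lambda_1-L_1)-L_6}{2(\lambda_1-L_1)+1}>0,$$ one has $\int_{V_h}\|x-y\|\,\pi_\tau^h(dy)<\infty$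 and $$\Big|P^h_m\phi(x)-\int_{V_h}\phi\,d\pi^h_\tau\Big|\le e^{-\gamma_6t_m/2}\,|\phi|_{\rm Lip}\int_{V_h}\|x-y\|\,\pi^h_\tau(dy)$$ for all $m\in\mathbb N$, $x\in H$ and all bounded Lipschitz $\phi:H\to\mathbb R$, where $|\phi|_{\rm Lip}=\sup_{x\ne y}|\phi(x)-\phi(y)|/\|x-y\|$. -/

import Mathlib

open MeasureTheory ProbabilityTheory Filter Topology
open scoped NNReal ENNReal

noncomputable section

namespace DIEG

/-! ### Function spaces on the domain -/

/-- The physical space `ℝᵈ` with its Euclidean norm. -/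
abbrev E (d : ℕ) := EuclideanSpace ℝ (Fin d)

variable {d : ℕ}

/-- The Hilbert space `H = L²(𝒪)`. -/
abbrev L2 (O : TopologicalSpace.Opens (E d)) :=
  Lp ℝ 2 (volume.restrict (O : Set (E d)))

/-- The Hilbert space `L²(𝒪; ℝᵈ)` of square integrable vector fields. -/
abbrev L2vec (O : TopologicalSpace.Opens (E d)) :=
  Lp (E d) 2 (volume.restrict (O : Set (E d)))

/-- `H` carries its Borel `σ`-algebra. -/
instance instMeasurableSpaceL2 (O : TopologicalSpace.Opens (E d)) : MeasurableSpace (L2 O) :=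
  borel _

instance instBorelSpaceL2 (O : TopologicalSpace.Opens (E d)) : BorelSpace (L2 O) := ⟨rfl⟩

open scoped ContDiff in
/-- Test functions: smooth with compact support in the open set `𝒪`. -/
def IsTest (O : TopologicalSpace.Opens (E d)) (φ : E d → ℝ) : Prop :=
  ContDiff ℝ ∞ φ ∧ HasCompactSupport φ ∧ tsupport φ ⊆ (O : Set (E d))

/-- `G` is the weak gradient of `u` on `𝒪`. -/
def HasWeakGrad (O : TopologicalSpace.Opens (E d)) (u : L2 O) (G : L2vec O) : Prop :=
  ∀ φ : E d → ℝ, IsTest O φ →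
    ∫ ξ in (O : Set (E d)), u ξ • gradient φ ξ = - ∫ ξ in (O : Set (E d)), φ ξ • G ξ

/-- The set of pairs `(φ, ∇φ)` in `L²(𝒪) × L²(𝒪; ℝᵈ)` with `φ` a test function. -/
def testGraph (O : TopologicalSpace.Opens (E d)) : Set (L2 O × L2vec O) :=
  {p | ∃ φ : E d → ℝ, IsTest O φ ∧
    p.1 =ᵐ[volume.restrict (O : Set (E d))] φ ∧
    p.2 =ᵐ[volume.restrict (O : Set (E d))] gradient φ}

lemma integrable_smul_Lp {O : TopologicalSpace.Opens (E d)} {φ : E d → ℝ} (hφ : IsTest O φ)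
    (G : L2vec O) : Integrable (fun ξ => φ ξ • G ξ) (volume.restrict (O : Set (E d))) := by
  have h1 : MemLp φ 2 (volume.restrict (O : Set (E d))) :=
    (hφ.1.continuous.memLp_of_hasCompactSupport hφ.2.1)
  exact memLp_one_iff_integrable.1 (MemLp.smul (p := 2) (q := 2) (r := 1) (Lp.memLp G) h1)

lemma integrable_grad_Lp {O : TopologicalSpace.Opens (E d)} {φ : E d → ℝ} (hφ : IsTest O φ)
    (u : L2 O) : Integrable (fun ξ => u ξ • gradient φ ξ) (volume.restrict (O : Set (E d))) := by
  have hc : Continuous (gradient φ) := by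
    have := hφ.1.continuous_fderiv (by simp)
    unfold gradient
    exact (LinearIsometryEquiv.continuous _).comp this
  have hs : HasCompactSupport (gradient φ) := by
    have := hφ.2.1.fderiv (𝕜 := ℝ)
    unfold gradient
    exact this.comp_left (g := fun z => (InnerProductSpace.toDual ℝ (E d)).symm z) (by simp)
  exact memLp_one_iff_integrable.1
    (MemLp.smul (p := 2) (q := 2) (r := 1) (hc.memLp_of_hasCompactSupport hs) (Lp.memLp u))

lemma HasWeakGrad.add {O : TopologicalSpace.Opens (E d)} {u v : L2 O} {G K : L2vec O}
    (hu : HasWeakGrad O u G) (hv : HasWeakGrad O v K) : HasWeakGrad O (u + v) (G + K) := by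
  intro φ hφ
  have e1 : ∫ ξ in (O : Set (E d)), (u + v : L2 O) ξ • gradient φ ξ =
      ∫ ξ in (O : Set (E d)), (u ξ • gradient φ ξ + v ξ • gradient φ ξ) := by
    refine integral_congr_ae ?_
    filter_upwards [Lp.coeFn_add u v] with ξ h
    rw [h, Pi.add_apply, add_smul]
  have e2 : ∫ ξ in (O : Set (E d)), φ ξ • (G + K : L2vec O) ξ =
      ∫ ξ in (O : Set (E d)), (φ ξ • G ξ + φ ξ • K ξ) := by
    refine integral_congr_ae ?_
    filter_upwards [Lp.coeFn_add G K] with ξ h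
    rw [h, Pi.add_apply, smul_add]
  rw [e1, e2, integral_add (integrable_grad_Lp hφ u) (integrable_grad_Lp hφ v),
    integral_add (integrable_smul_Lp hφ G) (integrable_smul_Lp hφ K), hu φ hφ, hv φ hφ, neg_add]

lemma HasWeakGrad.smul {O : TopologicalSpace.Opens (E d)} {u : L2 O} {G : L2vec O} (c : ℝ)
    (hu : HasWeakGrad O u G) : HasWeakGrad O (c • u) (c • G) := by
  intro φ hφ
  have e1 : ∫ ξ in (O : Set (E d)), (c • u : L2 O) ξ • gradient φ ξ =
      ∫ ξ in (O : Set (E d)), c • (u ξ • gradient φ ξ) := by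
    refine integral_congr_ae ?_
    filter_upwards [Lp.coeFn_smul c u] with ξ h
    rw [h, Pi.smul_apply, smul_assoc]
  have e2 : ∫ ξ in (O : Set (E d)), φ ξ • (c • G : L2vec O) ξ =
      ∫ ξ in (O : Set (E d)), c • (φ ξ • G ξ) := by
    refine integral_congr_ae ?_
    filter_upwards [Lp.coeFn_smul c G] with ξ h
    rw [h, Pi.smul_apply, smul_comm]
  rw [e1, e2, integral_smul, integral_smul, hu φ hφ, smul_neg]

lemma HasWeakGrad.unique {O : TopologicalSpace.Opens (E d)} {u : L2 O} {G K : L2vec O}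
    (hG : HasWeakGrad O u G) (hK : HasWeakGrad O u K) : G = K := by
  have h0 : HasWeakGrad O (u + (-1 : ℝ) • u) (G + (-1 : ℝ) • K) := hG.add (hK.smul (-1))
  have hu0 : u + (-1 : ℝ) • u = 0 := by simp
  rw [hu0] at h0
  set D : L2vec O := G + (-1 : ℝ) • K with hD
  have hloc : LocallyIntegrableOn D (O : Set (E d)) volume := by
    have hl : LocallyIntegrable D (volume.restrict (O : Set (E d))) :=
      (Lp.memLp D).locallyIntegrable (by norm_num)
    exact locallyIntegrableOn_of_locallyIntegrable_restrict hl
  have hz : ∀ᵐ ξ ∂volume, ξ ∈ (O : Set (E d)) → D ξ = 0 := by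
    refine O.isOpen.ae_eq_zero_of_integral_contDiff_smul_eq_zero hloc ?_
    intro φ h1 h2 h3
    have h4 := h0 φ ⟨h1, h2, h3⟩
    have h5 : ∫ ξ in (O : Set (E d)), (0 : L2 O) ξ • gradient φ ξ = 0 := by
      rw [← integral_zero (E d) (E d) (μ := volume.restrict (O : Set (E d)))]
      refine integral_congr_ae ?_
      filter_upwards [Lp.coeFn_zero ℝ 2 (volume.restrict (O : Set (E d)))] with ξ h
      rw [h, Pi.zero_apply, zero_smul]
    rw [h5, eq_comm, neg_eq_zero] at h4
    rw [← h4]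
    refine (setIntegral_eq_integral_of_forall_compl_eq_zero ?_).symm
    intro ξ hξ
    rw [image_eq_zero_of_notMem_tsupport (fun h => hξ (h3 h)), zero_smul]
  have hD0 : D = 0 := by
    rw [Lp.eq_zero_iff_ae_eq_zero]
    exact (ae_restrict_iff' O.isOpen.measurableSet).2 hz
  rw [hD] at hD0
  simpa [← sub_eq_add_neg, sub_eq_zero] using hD0

lemma IsTest.add {O : TopologicalSpace.Opens (E d)} {φ ψ : E d → ℝ} (hφ : IsTest O φ)
    (hψ : IsTest O ψ) : IsTest O (φ + ψ) := by
  refine ⟨hφ.1.add hψ.1, hφ.2.1.add hψ.2.1, ?_⟩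
  exact (tsupport_add φ ψ).trans (Set.union_subset hφ.2.2 hψ.2.2)

lemma IsTest.smul {O : TopologicalSpace.Opens (E d)} {φ : E d → ℝ} (c : ℝ) (hφ : IsTest O φ) :
    IsTest O (c • φ) := by
  refine ⟨contDiff_const.smul hφ.1, hφ.2.1.smul_left (f := fun _ => c), ?_⟩
  exact (closure_mono (Function.support_const_smul_subset c φ)).trans hφ.2.2

/-- The graph of the gradient on test functions is a linear subspace. -/
def testGraphSubmodule (O : TopologicalSpace.Opens (E d)) : Submodule ℝ (L2 O × L2vec O) where
  carrier := testGraph O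
  zero_mem' := by
    refine ⟨0, ⟨contDiff_const, HasCompactSupport.zero, by simp [tsupport]⟩, ?_, ?_⟩
    · exact Lp.coeFn_zero ℝ 2 _
    · have hg : gradient (0 : E d → ℝ) = 0 := by
        funext ξ
        simp [gradient]
      rw [hg]
      exact Lp.coeFn_zero (E d) 2 _
  add_mem' := by
    rintro p r ⟨φ, hφ, h1, h2⟩ ⟨ψ, hψ, h3, h4⟩
    refine ⟨φ + ψ, hφ.add hψ, ?_, ?_⟩
    · filter_upwards [Lp.coeFn_add p.1 r.1, h1, h3] with ξ a b c
      rw [Prod.fst_add, a, Pi.add_apply, Pi.add_apply, b, c]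
    · filter_upwards [Lp.coeFn_add p.2 r.2, h2, h4] with ξ a b c
      have e : gradient (φ + ψ) ξ = gradient φ ξ + gradient ψ ξ := by
        unfold gradient
        rw [fderiv_add (hφ.1.differentiable (by simp) ξ) (hψ.1.differentiable (by simp) ξ),
          map_add]
      rw [Prod.snd_add, a, Pi.add_apply, b, c, e]
  smul_mem' := by
    rintro c p ⟨φ, hφ, h1, h2⟩
    refine ⟨c • φ, hφ.smul c, ?_, ?_⟩
    · filter_upwards [Lp.coeFn_smul c p.1, h1] with ξ a b
      simp [a, b]
    · filter_upwards [Lp.coeFn_smul c p.2, h2] with ξ a b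
      have e : gradient (c • φ) ξ = c • gradient φ ξ := by
        unfold gradient
        rw [fderiv_const_smul (hφ.1.differentiable (by simp) ξ), map_smul]
      simp [a, b, e]

/-- The Sobolev space `Ḣ¹ = H¹₀(𝒪)` as a subspace of `L²(𝒪)`: those `u` having a weak gradient
`G` in `L²` such that `(u, G)` is a limit, in `L² × L²`, of pairs `(φₙ, ∇φₙ)` with test functions
`φₙ`; that is, the closure of the test functions in the `H¹` norm. -/
def H10 (O : TopologicalSpace.Opens (E d)) : Submodule ℝ (L2 O) where
  carrier := {u | ∃ G : L2vec O, HasWeakGrad O u G ∧ (u, G) ∈ closure (testGraph O)}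
  zero_mem' := ⟨0, by
    refine ⟨?_, subset_closure (testGraphSubmodule O).zero_mem⟩
    intro φ hφ
    have e1 : ∫ ξ in (O : Set (E d)), (0 : L2 O) ξ • gradient φ ξ =
        ∫ ξ in (O : Set (E d)), (0 : E d) := by
      refine integral_congr_ae ?_
      filter_upwards [Lp.coeFn_zero ℝ 2 (volume.restrict (O : Set (E d)))] with ξ h
      rw [h, Pi.zero_apply, zero_smul]
    have e2 : ∫ ξ in (O : Set (E d)), φ ξ • (0 : L2vec O) ξ =
        ∫ ξ in (O : Set (E d)), (0 : E d) := by
      refine integral_congr_ae ?_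
      filter_upwards [Lp.coeFn_zero (E d) 2 (volume.restrict (O : Set (E d)))] with ξ h
      rw [h, Pi.zero_apply, smul_zero]
    rw [e1, e2]
    simp⟩
  add_mem' := by
    rintro u v ⟨G, hG, hG'⟩ ⟨K, hK, hK'⟩
    exact ⟨G + K, hG.add hK, (testGraphSubmodule O).topologicalClosure.add_mem hG' hK'⟩
  smul_mem' := by
    rintro c u ⟨G, hG, hG'⟩
    exact ⟨c • G, hG.smul c, (testGraphSubmodule O).topologicalClosure.smul_mem c hG'⟩

/-- The weak gradient `∇ : H¹₀(𝒪) → L²(𝒪; ℝᵈ)`. -/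
def grad (O : TopologicalSpace.Opens (E d)) : H10 O →ₗ[ℝ] L2vec O where
  toFun u := u.2.choose
  map_add' u v :=
    (u + v).2.choose_spec.1.unique (u.2.choose_spec.1.add v.2.choose_spec.1)
  map_smul' c u :=
    (c • u).2.choose_spec.1.unique (u.2.choose_spec.1.smul c)

lemma hasWeakGrad_grad {O : TopologicalSpace.Opens (E d)} (u : H10 O) :
    HasWeakGrad O (u : L2 O) (grad O u) := u.2.choose_spec.1

/-- The first eigenvalue `λ₁` of the Dirichlet Laplacian on `𝒪`, given by the infimum over
`u ∈ H¹₀(𝒪) \ {0}` of the Rayleigh quotient `‖∇u‖² / ‖u‖²`. -/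
def firstEigenvalue (O : TopologicalSpace.Opens (E d)) : ℝ :=
  sInf {r | ∃ u : H10 O, u ≠ 0 ∧ r = ‖grad O u‖ ^ 2 / ‖(u : L2 O)‖ ^ 2}

/-- The dual `Ḣ⁻¹ = (Ḣ¹)*`: linear functionals on `H¹₀(𝒪)` bounded with respect to the
`H¹` norm. -/
def Hm1 (O : TopologicalSpace.Opens (E d)) : Submodule ℝ (Module.Dual ℝ (H10 O)) where
  carrier := {z | ∃ C : ℝ, ∀ v : H10 O, |z v| ≤ C * (‖(v : L2 O)‖ + ‖grad O v‖)}
  zero_mem' := ⟨0, by simp⟩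
  add_mem' := by
    rintro z w ⟨C, hC⟩ ⟨D, hD⟩
    refine ⟨C + D, fun v => ?_⟩
    rw [LinearMap.add_apply, add_mul]
    exact (abs_add_le _ _).trans (add_le_add (hC v) (hD v))
  smul_mem' := by
    rintro c z ⟨C, hC⟩
    refine ⟨|c| * C, fun v => ?_⟩
    rw [LinearMap.smul_apply, smul_eq_mul, abs_mul, mul_assoc]
    exact mul_le_mul_of_nonneg_left (hC v) (abs_nonneg c)

open Classical in
/-- The element of `Ḣ⁻¹` represented by a function `w` on `𝒪` through the duality product
`v ↦ ∫ w v` (this is the embedding into `Ḣ⁻¹` of `H`, and of every dual Lebesgue space that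
embeds into `Ḣ⁻¹`); zero when `w` does not represent an element of `Ḣ⁻¹`. -/
def toHm1 (O : TopologicalSpace.Opens (E d)) (w : E d → ℝ) : Hm1 O :=
  if h : ∃ z : Hm1 O, ∀ v : H10 O,
      Integrable (fun ξ => w ξ * (v : L2 O) ξ) (volume.restrict (O : Set (E d))) ∧
      (z : Module.Dual ℝ (H10 O)) v = ∫ ξ in (O : Set (E d)), w ξ * (v : L2 O) ξ
  then h.choose else 0

/-! ### The finite element space -/

/-- A partition of (the closure of) `𝒪` into finitely many closed cells with nonempty and pairwise
disjoint interiors, of diameter at most `h`. The cells may be simplices, or any other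
closed sets such as the curved pieces which are unavoidable at a curved boundary. -/
structure Partition (O : TopologicalSpace.Opens (E d)) (h : ℝ) where
  /-- the cells of the partition -/
  cells : Finset (Set (E d))
  isClosed : ∀ T ∈ cells, IsClosed T
  interior_nonempty : ∀ T ∈ cells, (interior T).Nonempty
  disjoint : ∀ T ∈ cells, ∀ T' ∈ cells, T ≠ T' → Disjoint (interior T) (interior T')
  cover : ⋃ T ∈ cells, T = closure (O : Set (E d))
  diam_le : ∀ T ∈ cells, Metric.diam T ≤ h

variable {O : TopologicalSpace.Opens (E d)} {h : ℝ}

/-- `v` is continuous on the closure of `𝒪`, vanishes on `∂𝒪`, and on each cell `T` of the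
partition equals the affine function `ξ ↦ (a T).1 ξ + (a T).2`. -/
def IsPiecewiseLinear (𝒯 : Partition O h) (v : E d → ℝ)
    (a : 𝒯.cells → Module.Dual ℝ (E d) × ℝ) : Prop :=
  ContinuousOn v (closure (O : Set (E d))) ∧
  (∀ ξ ∈ frontier (O : Set (E d)), v ξ = 0) ∧
  ∀ T : 𝒯.cells, ∀ ξ ∈ (T : Set (E d)), v ξ = (a T).1 ξ + (a T).2

lemma IsPiecewiseLinear.add {𝒯 : Partition O h} {v w : E d → ℝ}
    {a b : 𝒯.cells → Module.Dual ℝ (E d) × ℝ} (hv : IsPiecewiseLinear 𝒯 v a)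
    (hw : IsPiecewiseLinear 𝒯 w b) : IsPiecewiseLinear 𝒯 (v + w) (a + b) := by
  refine ⟨hv.1.add hw.1, fun ξ hξ => by simp [hv.2.1 ξ hξ, hw.2.1 ξ hξ], fun T ξ hξ => ?_⟩
  simp [hv.2.2 T ξ hξ, hw.2.2 T ξ hξ]
  ring

lemma IsPiecewiseLinear.smul {𝒯 : Partition O h} {v : E d → ℝ}
    {a : 𝒯.cells → Module.Dual ℝ (E d) × ℝ} (c : ℝ) (hv : IsPiecewiseLinear 𝒯 v a) :
    IsPiecewiseLinear 𝒯 (c • v) (c • a) := by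
  refine ⟨hv.1.const_smul c, fun ξ hξ => by simp [hv.2.1 ξ hξ], fun T ξ hξ => ?_⟩
  simp [hv.2.2 T ξ hξ]
  ring

lemma IsPiecewiseLinear.zero (𝒯 : Partition O h) : IsPiecewiseLinear 𝒯 0 0 :=
  ⟨continuousOn_const, fun _ _ => rfl, fun _ _ _ => by simp⟩

/-- The pairs of a family of affine functions on the cells and of the element of `L²(𝒪)` which
they define. -/
def pieces (𝒯 : Partition O h) :
    Submodule ℝ ((𝒯.cells → Module.Dual ℝ (E d) × ℝ) × L2 O) where
  carrier := {p | ∃ v : E d → ℝ, IsPiecewiseLinear 𝒯 v p.1 ∧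
    p.2 =ᵐ[volume.restrict (O : Set (E d))] v}
  zero_mem' := ⟨0, IsPiecewiseLinear.zero 𝒯, Lp.coeFn_zero ℝ 2 _⟩
  add_mem' := by
    rintro p r ⟨v, hv, hv'⟩ ⟨w, hw, hw'⟩
    refine ⟨v + w, hv.add hw, ?_⟩
    filter_upwards [Lp.coeFn_add p.2 r.2, hv', hw'] with ξ a b c
    rw [Prod.snd_add, a, Pi.add_apply, Pi.add_apply, b, c]
  smul_mem' := by
    rintro c p ⟨v, hv, hv'⟩
    refine ⟨c • v, hv.smul c, ?_⟩
    filter_upwards [Lp.coeFn_smul c p.2, hv'] with ξ a b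
    simp [a, b]

/-- The finite element space `V_h ⊂ Ḣ¹` of the continuous functions on the closure of `𝒪` which
are piecewise linear over the partition and vanish on the boundary, with the norm of `L²(𝒪)`. -/
def Vh (𝒯 : Partition O h) : Submodule ℝ (L2 O) where
  carrier := {u | u ∈ H10 O ∧ ∃ (v : E d → ℝ) (a : 𝒯.cells → Module.Dual ℝ (E d) × ℝ),
    IsPiecewiseLinear 𝒯 v a ∧ u =ᵐ[volume.restrict (O : Set (E d))] v}
  zero_mem' := ⟨(H10 O).zero_mem, 0, 0, IsPiecewiseLinear.zero 𝒯, Lp.coeFn_zero ℝ 2 _⟩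
  add_mem' := by
    rintro u w ⟨hu, v, a, hv, hv'⟩ ⟨hw, v', a', hw', hw''⟩
    obtain ⟨x, hx, hx'⟩ := (pieces 𝒯).add_mem (x := (a, u)) (y := (a', w))
      ⟨v, hv, hv'⟩ ⟨v', hw', hw''⟩
    exact ⟨(H10 O).add_mem hu hw, x, a + a', hx, hx'⟩
  smul_mem' := by
    rintro c u ⟨hu, v, a, hv, hv'⟩
    obtain ⟨x, hx, hx'⟩ := (pieces 𝒯).smul_mem c (x := (a, u)) ⟨v, hv, hv'⟩
    exact ⟨(H10 O).smul_mem c hu, x, c • a, hx, hx'⟩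

lemma Vh_le (𝒯 : Partition O h) : Vh 𝒯 ≤ H10 O := fun _ hu => hu.1

instance instFiniteDimensionalVh (𝒯 : Partition O h) : FiniteDimensional ℝ (Vh 𝒯) := by
  have hinj : Function.Injective
      ((LinearMap.fst ℝ (𝒯.cells → Module.Dual ℝ (E d) × ℝ) (L2 O)).comp
        (pieces 𝒯).subtype) := by
    refine (injective_iff_map_eq_zero _).2 ?_
    rintro ⟨⟨a, u⟩, v, hv, hv'⟩ h0
    have ha : a = 0 := by simpa using h0
    subst ha
    have hu : u = 0 := by
      rw [Lp.eq_zero_iff_ae_eq_zero]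
      filter_upwards [hv', ae_restrict_mem O.isOpen.measurableSet] with ξ h1 h2
      have h3 : ξ ∈ ⋃ T ∈ 𝒯.cells, T := by
        rw [𝒯.cover]
        exact subset_closure h2
      simp only [Set.mem_iUnion, exists_prop] at h3
      obtain ⟨T, hT, hξ⟩ := h3
      rw [h1, hv.2.2 ⟨T, hT⟩ ξ hξ]
      simp
    subst hu
    rfl
  have h1 : FiniteDimensional ℝ (pieces 𝒯) := FiniteDimensional.of_injective _ hinj
  have h2 : FiniteDimensional ℝ
      ((pieces 𝒯).map (LinearMap.snd ℝ (𝒯.cells → Module.Dual ℝ (E d) × ℝ) (L2 O))) :=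
    inferInstance
  refine Submodule.finiteDimensional_of_le (S₂ := (pieces 𝒯).map
    (LinearMap.snd ℝ (𝒯.cells → Module.Dual ℝ (E d) × ℝ) (L2 O))) ?_
  rintro u ⟨-, v, a, hv, hv'⟩
  exact ⟨(a, u), ⟨v, hv, hv'⟩, rfl⟩

/-- The element of `V_h` representing a linear functional with respect to the `L²` inner
product. -/
def riesz (𝒯 : Partition O h) : Module.Dual ℝ (Vh 𝒯) →ₗ[ℝ] Vh 𝒯 :=
  haveI : CompleteSpace (Vh 𝒯) := FiniteDimensional.complete ℝ _
  (InnerProductSpace.toDual ℝ (Vh 𝒯)).symm.toLinearEquiv.toLinearMap.comp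
    (LinearMap.toContinuousLinearMap : Module.Dual ℝ (Vh 𝒯) ≃ₗ[ℝ] _).toLinearMap

lemma inner_riesz (𝒯 : Partition O h) (z : Module.Dual ℝ (Vh 𝒯)) (v : Vh 𝒯) :
    inner ℝ v (riesz 𝒯 z) = z v := by
  have : CompleteSpace (Vh 𝒯) := FiniteDimensional.complete ℝ _
  rw [real_inner_comm]
  exact InnerProductSpace.toDual_symm_apply

/-- The gradient on `V_h ⊂ Ḣ¹`. -/
def gradVh (𝒯 : Partition O h) : Vh 𝒯 →ₗ[ℝ] L2vec O :=
  (grad O).comp (Submodule.inclusion (Vh_le 𝒯))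

/-- The discrete Laplacian `A_h : V_h → V_h`, `⟨v, A_h x⟩ = -⟨∇x, ∇v⟩`. -/
def Ah (𝒯 : Partition O h) : Vh 𝒯 →ₗ[ℝ] Vh 𝒯 :=
  -(riesz 𝒯).comp (((innerₗ (L2vec O)).compl₁₂ (gradVh 𝒯) (gradVh 𝒯)))

lemma inner_Ah (𝒯 : Partition O h) (x v : Vh 𝒯) :
    inner ℝ v (Ah 𝒯 x) = -inner ℝ (gradVh 𝒯 x) (gradVh 𝒯 v) := by
  simp only [Ah, LinearMap.neg_apply, LinearMap.comp_apply, inner_neg_right, inner_riesz]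
  rfl

/-- The generalized orthogonal projection `𝒫_h : Ḣ⁻¹ → V_h`, for which `⟨v, 𝒫_h z⟩` is the value
of the functional `z` at `v`. -/
def Ph (𝒯 : Partition O h) : Hm1 O →ₗ[ℝ] Vh 𝒯 :=
  (riesz 𝒯).comp
    ((Module.Dual.transpose (R := ℝ) (Submodule.inclusion (Vh_le 𝒯))).comp (Hm1 O).subtype)

lemma inner_Ph (𝒯 : Partition O h) (z : Hm1 O) (v : Vh 𝒯) :
    inner ℝ v (Ph 𝒯 z) = (z : Module.Dual ℝ (H10 O)) (Submodule.inclusion (Vh_le 𝒯) v) := by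
  simp only [Ph, LinearMap.comp_apply, inner_riesz]
  rfl

/-! ### The coefficients -/

/-- Differentiability, one-sided Lipschitz continuity, coercivity and polynomial growth
of the drift function, with the restriction on the growth exponent in dimension three. -/
structure DriftAssumption (d : ℕ) (f : ℝ → ℝ) (q L₁ L₂ L₃ L₄ L₅ : ℝ) : Prop where
  one_le : 1 ≤ q
  le_three : d = 3 → q ≤ 3
  differentiable : Differentiable ℝ f
  mono : ∀ ξ η : ℝ, (f ξ - f η) * (ξ - η) ≤ L₁ * (ξ - η) ^ 2
  coer : ∀ ξ : ℝ, f ξ * ξ ≤ L₂ * |ξ| ^ 2 + L₃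
  growth : ∀ ξ : ℝ, |deriv f ξ| ≤ L₄ * |ξ| ^ (q - 1) + L₅

/-- The self-adjoint positive definite trace class operator `Q` on `H` with its orthonormal basis
of eigenvectors `e k` and its eigenvalues `lam k > 0`, of finite sum. -/
structure IsCovariance (Q : L2 O →L[ℝ] L2 O) (e : HilbertBasis ℕ ℝ (L2 O)) (lam : ℕ → ℝ) :
    Prop where
  eigen : ∀ k, Q (e k) = lam k • e k
  pos : ∀ k, 0 < lam k
  trace : Summable lam

/-- The square, in `[0, ∞]`, of the Hilbert--Schmidt norm from `H₀ = Q^{1/2} H` to `H` of the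
operator which sends `e k` to the function `T k`; the `√(lam k) • e k` form an orthonormal basis
of `H₀`. -/
def hsNormSq (O : TopologicalSpace.Opens (E d)) (lam : ℕ → ℝ) (T : ℕ → E d → ℝ) : ℝ≥0∞ :=
  ∑' k, ENNReal.ofReal (lam k) * ∫⁻ ξ in (O : Set (E d)), ‖T k ξ‖ₑ ^ 2

/-- The Nemytskii diffusion operator `(G(x) u)(ξ) = g(x(ξ)) u(ξ)`. -/
def nemG (g : ℝ → ℝ) (x u : E d → ℝ) : E d → ℝ := fun ξ => g (x ξ) * u ξ

/-- `G` maps `H` into the Hilbert--Schmidt operators from `H₀` to `H`, is Lipschitz continuous and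
has linear growth. -/
structure DiffusionAssumption (e : HilbertBasis ℕ ℝ (L2 O)) (lam : ℕ → ℝ) (g : ℝ → ℝ)
    (L₆ L₇ L₈ : ℝ) : Prop where
  nonneg₆ : 0 ≤ L₆
  nonneg₇ : 0 ≤ L₇
  nonneg₈ : 0 ≤ L₈
  memLp : ∀ (x : L2 O) (k : ℕ), MemLp (nemG g x (e k)) 2 (volume.restrict (O : Set (E d)))
  lip : ∀ x y : L2 O, hsNormSq O lam (fun k => nemG g x (e k) - nemG g y (e k)) ≤
    ENNReal.ofReal (L₆ * ‖x - y‖ ^ 2)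
  growth : ∀ x : L2 O, hsNormSq O lam (fun k => nemG g x (e k)) ≤
    ENNReal.ofReal (L₇ * ‖x‖ ^ 2 + L₈)

/-! ### The noise and the scheme -/

variable {Ω : Type*} [MeasurableSpace Ω]

/-- `W` is an `H`-valued `Q`-Wiener process on the filtered probability space `(Ω, 𝓕, P)`:
it is adapted, starts at zero, has continuous paths, and its increments over `[s, t]` are
independent of `𝓕 s` and centred Gaussian with covariance `(t - s) Q`. -/
structure IsQWiener (Q : L2 O →L[ℝ] L2 O) (P : Measure Ω) (𝓕 : Filtration ℝ≥0 ‹MeasurableSpace Ω›)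
    (W : ℝ≥0 → Ω → L2 O) : Prop where
  adapted : ∀ t, Measurable[𝓕 t] (W t)
  zero : ∀ᵐ ω ∂P, W 0 ω = 0
  continuous : ∀ᵐ ω ∂P, Continuous fun t => W t ω
  indep : ∀ s t, s ≤ t →
    Indep (MeasurableSpace.comap (fun ω => W t ω - W s ω) inferInstance) (𝓕 s) P
  gaussian : ∀ s t, s ≤ t → ∀ u : L2 O,
    P.map (fun ω => inner ℝ (W t ω - W s ω) u) =
      gaussianReal 0 ((t - s) * (inner ℝ (Q u) u).toNNReal)

/-- `X` is a solution, starting from `𝒫_h x`, of the fully discrete scheme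
`X_{m+1} = X_m + τ A_h X_{m+1} + τ 𝒫_h F(X_{m+1}) + 𝒫_h G(X_m) (W(t_{m+1}) - W(t_m))`, `t_m = m τ`,
where `F(x)(ξ) = f(x(ξ))`. -/
structure IsSolution (𝒯 : Partition O h) (f g : ℝ → ℝ) (P : Measure Ω)
    (𝓕 : Filtration ℝ≥0 ‹MeasurableSpace Ω›) (W : ℝ≥0 → Ω → L2 O) (τ : ℝ≥0) (x : L2 O)
    (X : ℕ → Ω → Vh 𝒯) : Prop where
  adapted : ∀ m : ℕ, Measurable[𝓕 (m * τ)] (X m)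
  init : ∀ᵐ ω ∂P, X 0 ω = Ph 𝒯 (toHm1 O x)
  step : ∀ᵐ ω ∂P, ∀ m : ℕ,
    X (m + 1) ω = X m ω + (τ : ℝ) • Ah 𝒯 (X (m + 1) ω)
      + (τ : ℝ) • Ph 𝒯 (toHm1 O fun ξ => f ((X (m + 1) ω : L2 O) ξ))
      + Ph 𝒯 (toHm1 O (nemG g (X m ω : L2 O) (W ((m + 1) * τ) ω - W (m * τ) ω : L2 O)))

/-! ### Semigroup, invariant measures -/

/-- The Markov semigroup `(P_m φ)(x) = 𝔼 φ(X_m^x)` of a family of processes `X^x`, `x ∈ H`. -/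
def semigroup {𝒯 : Partition O h} (P : Measure Ω) (X : L2 O → ℕ → Ω → Vh 𝒯) (m : ℕ)
    (φ : Vh 𝒯 → ℝ) (x : L2 O) : ℝ :=
  ∫ ω, φ (X x m ω) ∂P

/-- `π` is an invariant probability measure on `V_h`. -/
def IsInvariant {𝒯 : Partition O h} (P : Measure Ω) (X : L2 O → ℕ → Ω → Vh 𝒯)
    (π : ProbabilityMeasure (Vh 𝒯)) : Prop :=
  ∀ (φ : BoundedContinuousFunction (Vh 𝒯) ℝ) (m : ℕ),
    ∫ x : Vh 𝒯, semigroup P X m φ (x : L2 O) ∂(π : Measure (Vh 𝒯)) =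
      ∫ x, φ x ∂(π : Measure (Vh 𝒯))

/-- The class `Lip_b(H)` of bounded Lipschitz continuous functions. -/
def IsLipB (φ : L2 O → ℝ) : Prop :=
  (∃ C : ℝ, ∀ x, |φ x| ≤ C) ∧ ∃ K : ℝ≥0, LipschitzWith K φ

/-- `|φ|_Lip`, the supremum of `|φ(x) - φ(y)| / ‖x - y‖` over `x ≠ y`. -/
def lipNorm (φ : L2 O → ℝ) : ℝ :=
  sSup {r | ∃ x y : L2 O, x ≠ y ∧ r = |φ x - φ y| / ‖x - y‖}

/-- The mixing rate `γ₆ = (2 (λ₁ - L₁) - L₆) / (2 (λ₁ - L₁) + 1)`. -/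
def gamma6 (O : TopologicalSpace.Opens (E d)) (L₁ L₆ : ℝ) : ℝ :=
  (2 * (firstEigenvalue O - L₁) - L₆) / (2 * (firstEigenvalue O - L₁) + 1)

end DIEG

end

/-! One step of the scheme is a random map `Ψ(x, u) = S(x + N(x) u)` on the finite dimensional space
`V_h`. Here `u` is a Gaussian increment, `N(x)` is the projected diffusion operator, and `S` inverts
`y ↦ y - τ A_h y - τ 𝒫_h F(y)`. By the variational definition of `λ₁` and the one-sided Lipschitz
bound on `f`, this map is strongly monotone with constant `c = 1 + τ (λ₁ - L₁)`. Hence `S` exists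
and is `1/c`-Lipschitz (`exists_resolvent`), and the implicit scheme becomes an explicit recursion
(`isSolution_iff`).

Run two copies with the same noise. The increment is centred with covariance `τ Q`, so the cross
term vanishes and `𝔼‖x - y + (N x - N y) u‖² = ‖x - y‖² + τ ‖N x - N y‖²_HS ≤ (1 + τ L₆) ‖x - y‖²`
(`lintegral_affine_sq`). Dividing by `c²` and applying `contraction_rate_le` and Jensen gives a
contraction in mean with factor `r = e^{-γ₆ τ / 2}` (`lintegral_stepMap_sub_le`). The Markov
operator `B` therefore shrinks Lipschitz constants by `r`.

The rest holds for any such recursion. Telescoping bounds the first moments of the chain started at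
zero uniformly, so its laws are tight. A limit point is invariant because `B^(m+1) φ(0) - B^m φ(0)`
tends to zero for Lipschitz `φ` (`exists_invariant_integrable_norm`). Integrating the Lipschitz
bound of `B^m φ` against the invariant measure gives mixing, and mixing forces uniqueness
(`eq_of_invariant`). For a starting point `x ∈ H` outside `V_h`, the orthogonal projection costs
nothing, since it is nonexpansive and fixes `V_h`. -/

noncomputable section

namespace DIEG

open BoundedContinuousFunction

/-! ### Random recursions that contract in mean: invariant measures and mixing. -/

section Markov

/-- The bounded Lipschitz function `min ‖x‖ N`. -/
def truncNorm (V : Type*) [NormedAddCommGroup V] (N : ℕ) : V →ᵇ ℝ :=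
  BoundedContinuousFunction.ofNormedAddCommGroup (fun x => min ‖x‖ N)
    (continuous_norm.min continuous_const) N (fun x => by
      rw [Real.norm_of_nonneg (by positivity)]
      exact min_le_right _ _)

lemma truncNorm_apply {V : Type*} [NormedAddCommGroup V] (N : ℕ) (x : V) :
    truncNorm V N x = min ‖x‖ N := rfl

lemma lipschitz_truncNorm {V : Type*} [NormedAddCommGroup V] (N : ℕ) :
    LipschitzWith 1 (truncNorm V N) :=
  lipschitzWith_one_norm.min_const _

variable {V U : Type*} [NormedAddCommGroup V] [MeasurableSpace V] [BorelSpace V]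
  [MeasurableSpace U]

/-- Bounded Lipschitz functions separate probability measures. -/
lemma probabilityMeasure_eq_of_lipschitz {μ ν : ProbabilityMeasure V}
    (H : ∀ (φ : V →ᵇ ℝ) (K : ℝ≥0), LipschitzWith K φ →
      ∫ x, φ x ∂(μ : Measure V) = ∫ x, φ x ∂(ν : Measure V)) : μ = ν := by
  have h1 : Tendsto (fun _ : ℕ => μ) atTop (𝓝 ν) := by
    refine tendsto_iff_forall_lipschitz_integral_tendsto.2 ?_
    rintro φ ⟨C, hC⟩ ⟨K, hK⟩
    have := H (BoundedContinuousFunction.mkOfBound ⟨φ, hK.continuous⟩ C hC) K hK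
    simp only [BoundedContinuousFunction.mkOfBound_coe, ContinuousMap.coe_mk] at this
    rw [this]
    exact tendsto_const_nhds
  exact tendsto_nhds_unique tendsto_const_nhds h1

/-- The Markov operator `(Bφ)(x) = 𝔼 φ(Ψ(x, ξ))`, `ξ ∼ ν`, of a random recursion which is continuous
in the state. -/
def markovOp (Ψ : V → U → V) (ν : Measure U) [IsProbabilityMeasure ν]
    (hΨ : Measurable (Function.uncurry Ψ)) (hc : ∀ u, Continuous fun x => Ψ x u)
    (φ : V →ᵇ ℝ) : V →ᵇ ℝ :=
  BoundedContinuousFunction.ofNormedAddCommGroup (fun x => ∫ u, φ (Ψ x u) ∂ν)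
    (continuous_of_dominated (bound := fun _ => ‖φ‖)
      (fun _ => (φ.continuous.measurable.comp
        (hΨ.comp measurable_prodMk_left)).aestronglyMeasurable)
      (fun x => ae_of_all _ fun u => φ.norm_coe_le_norm _)
      (integrable_const _)
      (ae_of_all _ fun u => φ.continuous.comp (hc u)))
    ‖φ‖
    (fun x => by
      simpa using norm_integral_le_of_norm_le_const (μ := ν)
        (ae_of_all ν fun u => φ.norm_coe_le_norm (Ψ x u)))

variable {Ψ : V → U → V} {ν : Measure U} [IsProbabilityMeasure ν]
  {hΨ : Measurable (Function.uncurry Ψ)} {hc : ∀ u, Continuous fun x => Ψ x u}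

lemma markovOp_apply (φ : V →ᵇ ℝ) (x : V) :
    markovOp Ψ ν hΨ hc φ x = ∫ u, φ (Ψ x u) ∂ν := rfl

lemma integrable_comp_step (hΨ : Measurable (Function.uncurry Ψ)) (φ : V →ᵇ ℝ) (x : V) :
    Integrable (fun u => φ (Ψ x u)) ν :=
  Integrable.of_bound (φ.continuous.measurable.comp
    (hΨ.comp measurable_prodMk_left)).aestronglyMeasurable ‖φ‖
    (ae_of_all _ fun u => φ.norm_coe_le_norm _)

lemma integral_iterate_markovOp {π : ProbabilityMeasure V}
    (hπ : ∀ φ : V →ᵇ ℝ, ∫ x, markovOp Ψ ν hΨ hc φ x ∂(π : Measure V) = ∫ x, φ x ∂(π : Measure V))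
    (m : ℕ) (φ : V →ᵇ ℝ) :
    ∫ x, (markovOp Ψ ν hΨ hc)^[m] φ x ∂(π : Measure V) = ∫ x, φ x ∂(π : Measure V) := by
  induction m with
  | zero => rfl
  | succ m ih => rw [Function.iterate_succ_apply', hπ, ih]

variable [SecondCountableTopology V]

lemma measurable_step_sub (hΨ : Measurable (Function.uncurry Ψ)) (x y : V) :
    Measurable fun u => Ψ x u - Ψ y u :=
  (hΨ.comp measurable_prodMk_left).sub (hΨ.comp measurable_prodMk_left)

/-- Synchronous coupling: both starting points are driven by the same `u`, so the contraction of `Ψ`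
in mean passes to the Lipschitz constant. -/
lemma lipschitz_markovOp {r K : ℝ≥0}
    (hr : ∀ x y, ∫⁻ u, ‖Ψ x u - Ψ y u‖ₑ ∂ν ≤ r * ‖x - y‖ₑ)
    {φ : V →ᵇ ℝ} (hφ : LipschitzWith K φ) : LipschitzWith (K * r) (markovOp Ψ ν hΨ hc φ) := by
  intro x y
  rw [edist_eq_enorm_sub, edist_eq_enorm_sub, markovOp_apply, markovOp_apply,
    ← integral_sub (integrable_comp_step hΨ φ x) (integrable_comp_step hΨ φ y)]
  calc ‖∫ u, (φ (Ψ x u) - φ (Ψ y u)) ∂ν‖ₑ ≤ ∫⁻ u, ‖φ (Ψ x u) - φ (Ψ y u)‖ₑ ∂ν :=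
        enorm_integral_le_lintegral_enorm _
    _ ≤ ∫⁻ u, K * ‖Ψ x u - Ψ y u‖ₑ ∂ν := by
        refine lintegral_mono fun u => ?_
        rw [← edist_eq_enorm_sub, ← edist_eq_enorm_sub]
        exact hφ _ _
    _ = K * ∫⁻ u, ‖Ψ x u - Ψ y u‖ₑ ∂ν :=
        lintegral_const_mul _ (measurable_step_sub hΨ x y).enorm
    _ ≤ K * (r * ‖x - y‖ₑ) := by gcongr; exact hr x y
    _ = _ := by rw [ENNReal.coe_mul, mul_assoc]

lemma lipschitz_iterate_markovOp {r K : ℝ≥0}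
    (hr : ∀ x y, ∫⁻ u, ‖Ψ x u - Ψ y u‖ₑ ∂ν ≤ r * ‖x - y‖ₑ)
    {φ : V →ᵇ ℝ} (hφ : LipschitzWith K φ) (m : ℕ) :
    LipschitzWith (K * r ^ m) ((markovOp Ψ ν hΨ hc)^[m] φ) := by
  induction m with
  | zero => simpa using hφ
  | succ m ih =>
    rw [Function.iterate_succ_apply', pow_succ, ← mul_assoc]
    exact lipschitz_markovOp hr ih

/-- The difference is the mean of `ψ(Ψ(0, u)) - ψ(0)` with `ψ = B^m φ`, whose Lipschitz constant is
`K r^m`. The geometric decay serves twice: summed, it bounds moments; as a limit, it gives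
invariance. -/
lemma abs_iterate_succ_sub_le {r K : ℝ≥0} {C : ℝ≥0}
    (hr : ∀ x y, ∫⁻ u, ‖Ψ x u - Ψ y u‖ₑ ∂ν ≤ r * ‖x - y‖ₑ)
    (h0 : ∫⁻ u, ‖Ψ 0 u‖ₑ ∂ν ≤ C) {φ : V →ᵇ ℝ} (hφ : LipschitzWith K φ) (m : ℕ) :
    |(markovOp Ψ ν hΨ hc)^[m + 1] φ 0 - (markovOp Ψ ν hΨ hc)^[m] φ 0| ≤ K * r ^ m * C := by
  have hL := lipschitz_iterate_markovOp (hΨ := hΨ) (hc := hc) hr hφ m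
  rw [Function.iterate_succ_apply', markovOp_apply]
  set ψ := (markovOp Ψ ν hΨ hc)^[m] φ
  have h1 : ∫ u, ψ (Ψ 0 u) ∂ν - ψ 0 = ∫ u, (ψ (Ψ 0 u) - ψ 0) ∂ν := by
    rw [integral_sub (integrable_comp_step hΨ ψ 0) (integrable_const _)]
    simp
  have h2 : ‖∫ u, (ψ (Ψ 0 u) - ψ 0) ∂ν‖ₑ ≤ ((K * r ^ m * C : ℝ≥0) : ℝ≥0∞) :=
    calc ‖∫ u, (ψ (Ψ 0 u) - ψ 0) ∂ν‖ₑ ≤ ∫⁻ u, ‖ψ (Ψ 0 u) - ψ 0‖ₑ ∂ν :=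
          enorm_integral_le_lintegral_enorm _
      _ ≤ ∫⁻ u, (K * r ^ m : ℝ≥0) * ‖Ψ 0 u‖ₑ ∂ν := by
          refine lintegral_mono fun u => ?_
          have := hL (Ψ 0 u) 0
          rwa [edist_eq_enorm_sub, edist_eq_enorm_sub, sub_zero] at this
      _ = (K * r ^ m : ℝ≥0) * ∫⁻ u, ‖Ψ 0 u‖ₑ ∂ν :=
          lintegral_const_mul _ (hΨ.comp measurable_prodMk_left).enorm
      _ ≤ _ := by rw [ENNReal.coe_mul (K * r ^ m)]; gcongr
  rw [h1, ← Real.norm_eq_abs]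
  have h3 := ENNReal.toReal_mono ENNReal.coe_ne_top h2
  simpa using h3

/-- Telescoping over the steps gives a geometric series. The truncated norms are all 1-Lipschitz and
vanish at zero, so the bound depends neither on `m` nor on the truncation level. -/
lemma iterate_truncNorm_le {r : ℝ≥0} {C : ℝ≥0} (hr1 : r < 1)
    (hr : ∀ x y, ∫⁻ u, ‖Ψ x u - Ψ y u‖ₑ ∂ν ≤ r * ‖x - y‖ₑ)
    (h0 : ∫⁻ u, ‖Ψ 0 u‖ₑ ∂ν ≤ C) (N m : ℕ) :
    (markovOp Ψ ν hΨ hc)^[m] (truncNorm V N) 0 ≤ C / (1 - r) := by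
  have hr1' : (r : ℝ) < 1 := by exact_mod_cast hr1
  have h1 : ∀ m, (markovOp Ψ ν hΨ hc)^[m] (truncNorm V N) 0 ≤
      ∑ j ∈ Finset.range m, (r : ℝ) ^ j * C := by
    intro m
    induction m with
    | zero => simp [truncNorm_apply]
    | succ m ih =>
      rw [Finset.sum_range_succ]
      have := (abs_le.1 (abs_iterate_succ_sub_le (hΨ := hΨ) (hc := hc) hr h0
        (lipschitz_truncNorm N) m)).2
      simp only [NNReal.coe_one, one_mul] at this
      linarith
  refine (h1 m).trans ?_
  rw [← Finset.sum_mul, mul_comm, div_eq_mul_inv]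
  gcongr
  rw [← tsum_geometric_of_lt_one r.coe_nonneg hr1']
  exact (summable_geometric_of_lt_one r.coe_nonneg hr1').sum_le_tsum _ (fun _ _ => by positivity)

/-- A random recursion that contracts in mean has an invariant measure of finite first moment: a
limit point of the laws `ρ m` of the chain started at zero, which are tight. -/
theorem exists_invariant_integrable_norm [ProperSpace V] {r : ℝ≥0} {C : ℝ≥0} (hr1 : r < 1)
    (hr : ∀ x y, ∫⁻ u, ‖Ψ x u - Ψ y u‖ₑ ∂ν ≤ r * ‖x - y‖ₑ)
    (h0 : ∫⁻ u, ‖Ψ 0 u‖ₑ ∂ν ≤ C) (ρ : ℕ → ProbabilityMeasure V)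
    (hρ : ∀ m (φ : V →ᵇ ℝ), ∫ x, φ x ∂(ρ m : Measure V) = (markovOp Ψ ν hΨ hc)^[m] φ 0) :
    ∃ π : ProbabilityMeasure V,
      (∀ φ : V →ᵇ ℝ, ∫ x, markovOp Ψ ν hΨ hc φ x ∂(π : Measure V) = ∫ x, φ x ∂(π : Measure V)) ∧
      Integrable (fun x => ‖x‖) (π : Measure V) := by
  have hr1' : (r : ℝ) < 1 := by exact_mod_cast hr1
  -- tightness
  have htight : IsTightMeasureSet {((μ : ProbabilityMeasure V) : Measure V) | μ ∈ Set.range ρ} := by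
    rw [isTightMeasureSet_iff_exists_isCompact_measure_compl_le]
    intro ε hε
    -- Markov's inequality for the norm truncated at `N + 1` bounds the mass outside the ball of
    -- radius `N + 1`; the shift keeps the radius positive.
    obtain ⟨N, hN⟩ : ∃ N : ℕ, ENNReal.ofReal (C / (1 - r) / (N + 1 : ℕ)) ≤ ε := by
      have ht : Tendsto (fun N : ℕ => ENNReal.ofReal (C / (1 - r) / (N + 1 : ℕ))) atTop (𝓝 0) := by
        rw [← ENNReal.ofReal_zero]
        exact ENNReal.tendsto_ofReal ((tendsto_const_div_atTop_nhds_zero_nat _).comp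
          (tendsto_add_atTop_nat 1))
      exact (ht.eventually (eventually_le_nhds hε)).exists
    refine ⟨Metric.closedBall 0 (N + 1 : ℕ), isCompact_closedBall _ _, ?_⟩
    rintro _ ⟨_, ⟨m, rfl⟩, rfl⟩
    refine le_trans ?_ hN
    have hN0 : (0 : ℝ) < (N + 1 : ℕ) := by positivity
    refine (ENNReal.le_ofReal_iff_toReal_le (measure_ne_top _ _)
      (div_nonneg (div_nonneg C.2 (by linarith)) hN0.le)).2 ((le_div_iff₀ hN0).2 ?_)
    have h1 := mul_meas_ge_le_integral_of_nonneg (μ := (ρ m : Measure V))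
      (f := truncNorm V (N + 1)) (ae_of_all _ fun x => by simp [truncNorm_apply]; positivity)
      ((truncNorm V (N + 1)).integrable _) (N + 1 : ℕ)
    rw [hρ] at h1
    refine le_trans ?_ (h1.trans (iterate_truncNorm_le hr1 hr h0 _ _))
    rw [mul_comm]
    refine mul_le_mul_of_nonneg_left ?_ (by positivity)
    refine measureReal_mono ?_
    intro x hx
    simp only [Set.mem_compl_iff, Metric.mem_closedBall, dist_zero_right, not_le] at hx
    simp only [Set.mem_ofPred_eq, truncNorm_apply, le_min_iff]
    exact ⟨hx.le, le_rfl⟩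
  -- Prokhorov: the laws have compact closure. Taking the limit along a nonprincipal ultrafilter
  -- avoids extracting a subsequence.
  obtain ⟨π, -, hπ⟩ := (isCompact_closure_of_isTightMeasureSet htight).ultrafilter_le_nhds
    ((hyperfilter ℕ).map ρ) (by
      rw [le_principal_iff]
      exact Filter.mem_map.2 (univ_mem' fun m => subset_closure ⟨m, rfl⟩))
  have hπ' : Tendsto ρ (hyperfilter ℕ) (𝓝 π) := hπ
  have hlim : ∀ φ : V →ᵇ ℝ, Tendsto (fun m => (markovOp Ψ ν hΨ hc)^[m] φ 0) (hyperfilter ℕ)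
      (𝓝 (∫ x, φ x ∂(π : Measure V))) := by
    intro φ
    have := ProbabilityMeasure.tendsto_iff_forall_integral_tendsto.1 hπ' φ
    simpa only [hρ] using this
  refine ⟨π, ?_, ?_⟩
  · -- invariance on Lipschitz functions, hence equality of the measures
    have hm : Measurable fun p : V × U => Ψ p.1 p.2 := hΨ
    -- The law after one step from `π`. Invariance for all bounded continuous functions reduces to
    -- `π' = π`, which Lipschitz test functions detect.
    let π' : ProbabilityMeasure V :=
      ⟨((π : Measure V).prod ν).map (fun p => Ψ p.1 p.2),
        Measure.isProbabilityMeasure_map hm.aemeasurable⟩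
    have hπ'i : ∀ φ : V →ᵇ ℝ, ∫ x, φ x ∂(π' : Measure V) =
        ∫ x, markovOp Ψ ν hΨ hc φ x ∂(π : Measure V) := by
      intro φ
      change ∫ x, φ x ∂(((π : Measure V).prod ν).map (fun p => Ψ p.1 p.2)) = _
      rw [integral_map hm.aemeasurable φ.continuous.measurable.aestronglyMeasurable,
        integral_prod]
      · rfl
      · exact Integrable.of_bound (φ.continuous.measurable.comp hm).aestronglyMeasurable ‖φ‖
          (ae_of_all _ fun u => φ.norm_coe_le_norm _)
    have heq : π' = π := by
      refine probabilityMeasure_eq_of_lipschitz fun φ K hφ => ?_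
      rw [hπ'i]
      have h1 := (hlim (markovOp Ψ ν hΨ hc φ)).sub (hlim φ)
      have h2 : Tendsto (fun m : ℕ => (K : ℝ) * r ^ m * C) (hyperfilter ℕ) (𝓝 0) := by
        have : Tendsto (fun m : ℕ => (K : ℝ) * r ^ m * C) atTop (𝓝 (K * 0 * C)) :=
          ((tendsto_pow_atTop_nhds_zero_of_lt_one r.2 hr1').const_mul _).mul_const _
        simp only [mul_zero, zero_mul] at this
        exact this.mono_left Nat.hyperfilter_le_atTop
      -- Since `B^m (B φ) = B^(m+1) φ`, this is the one-step difference at zero, which decays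
      -- geometrically.
      have h3 : Tendsto (fun m => (markovOp Ψ ν hΨ hc)^[m] (markovOp Ψ ν hΨ hc φ) 0 -
          (markovOp Ψ ν hΨ hc)^[m] φ 0) (hyperfilter ℕ) (𝓝 0) := by
        refine squeeze_zero_norm (fun m => ?_) h2
        rw [← Function.iterate_succ_apply]
        exact abs_iterate_succ_sub_le hr h0 hφ m
      exact sub_eq_zero.1 (tendsto_nhds_unique h1 h3)
    intro φ
    rw [← hπ'i, heq]
  · -- the first moment
    have hb : ∀ N : ℕ, ∫ x, truncNorm V N x ∂(π : Measure V) ≤ C / (1 - r) := fun N =>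
      le_of_tendsto (hlim (truncNorm V N)) (Eventually.of_forall fun m =>
        iterate_truncNorm_le hr1 hr h0 N m)
    refine ⟨continuous_norm.measurable.aestronglyMeasurable, ?_⟩
    have hle : ∫⁻ x, ‖‖x‖‖ₑ ∂(π : Measure V) ≤ ENNReal.ofReal (C / (1 - r)) := by
      -- Weak convergence only sees bounded functions; monotone convergence removes the truncation
      -- from the uniform bound.
      have h1 : ∀ x : V, ‖‖x‖‖ₑ = ⨆ N : ℕ, ENNReal.ofReal (truncNorm V N x) := by
        intro x
        rw [enorm_norm, ← ofReal_norm]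
        refine le_antisymm ?_ (iSup_le fun N => ENNReal.ofReal_le_ofReal (min_le_left _ _))
        obtain ⟨N, hN⟩ := exists_nat_ge ‖x‖
        refine le_iSup_of_le N (ENNReal.ofReal_le_ofReal ?_)
        rw [truncNorm_apply, min_eq_left hN]
      simp_rw [h1]
      rw [lintegral_iSup]
      · refine iSup_le fun N => ?_
        rw [← ofReal_integral_eq_lintegral_ofReal ((truncNorm V N).integrable _)
          (ae_of_all _ fun x => by simp only [truncNorm_apply]; positivity)]
        exact ENNReal.ofReal_le_ofReal (hb N)
      · exact fun N => ((truncNorm V N).continuous.measurable).ennreal_ofReal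
      · intro N M hNM x
        refine ENNReal.ofReal_le_ofReal ?_
        simp only [truncNorm_apply]
        exact min_le_min le_rfl (by exact_mod_cast hNM)
    exact hle.trans_lt ENNReal.ofReal_lt_top

/-- By invariance `π(φ) = π(B^m φ)`, so the left side is an average over `y` of `B^m φ(x) - B^m
φ(y)`, controlled by the Lipschitz constant `K r^m`. -/
lemma abs_iterate_sub_integral_le {r : ℝ≥0}
    (hr : ∀ x y, ∫⁻ u, ‖Ψ x u - Ψ y u‖ₑ ∂ν ≤ r * ‖x - y‖ₑ) {π : ProbabilityMeasure V}
    (hπ : ∀ φ : V →ᵇ ℝ, ∫ x, markovOp Ψ ν hΨ hc φ x ∂(π : Measure V) = ∫ x, φ x ∂(π : Measure V))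
    (hi : Integrable (fun x => ‖x‖) (π : Measure V)) {K : ℝ≥0} {φ : V →ᵇ ℝ}
    (hφ : LipschitzWith K φ) (m : ℕ) (x : V) :
    |(markovOp Ψ ν hΨ hc)^[m] φ x - ∫ y, φ y ∂(π : Measure V)| ≤
      K * r ^ m * ∫ y, ‖x - y‖ ∂(π : Measure V) := by
  have hL := lipschitz_iterate_markovOp (hΨ := hΨ) (hc := hc) hr hφ m
  rw [← integral_iterate_markovOp hπ m φ]
  set ψ := (markovOp Ψ ν hΨ hc)^[m] φ
  have h1 : ψ x - ∫ y, ψ y ∂(π : Measure V) = ∫ y, (ψ x - ψ y) ∂(π : Measure V) := by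
    rw [integral_sub (integrable_const _) (ψ.integrable _)]
    simp
  have h2 : Integrable (fun y => ‖x - y‖) (π : Measure V) := by
    have : Integrable (fun y : V => y) (π : Measure V) :=
      (integrable_norm_iff measurable_id.aestronglyMeasurable).1 hi
    exact ((integrable_const x).sub this).norm
  rw [h1, ← integral_const_mul, ← Real.norm_eq_abs]
  refine norm_integral_le_of_norm_le (h2.const_mul _) (ae_of_all _ fun y => ?_)
  have := hL.dist_le_mul x y
  rwa [Real.dist_eq, dist_eq_norm, ← Real.norm_eq_abs] at this

/-- Integrate the pointwise convergence `B^m φ → π(φ)` against `π'`. Only `π` needs a first moment: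
for `π'`, domination by `‖φ‖` suffices. -/
lemma eq_of_invariant {r : ℝ≥0} (hr1 : r < 1)
    (hr : ∀ x y, ∫⁻ u, ‖Ψ x u - Ψ y u‖ₑ ∂ν ≤ r * ‖x - y‖ₑ) {π π' : ProbabilityMeasure V}
    (hπ : ∀ φ : V →ᵇ ℝ, ∫ x, markovOp Ψ ν hΨ hc φ x ∂(π : Measure V) = ∫ x, φ x ∂(π : Measure V))
    (hπ' : ∀ φ : V →ᵇ ℝ, ∫ x, markovOp Ψ ν hΨ hc φ x ∂(π' : Measure V) = ∫ x, φ x ∂(π' : Measure V))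
    (hi : Integrable (fun x => ‖x‖) (π : Measure V)) : π' = π := by
  have hr1' : (r : ℝ) < 1 := by exact_mod_cast hr1
  refine probabilityMeasure_eq_of_lipschitz fun φ K hφ => ?_
  have hbound : ∀ m, ‖(markovOp Ψ ν hΨ hc)^[m] φ‖ ≤ ‖φ‖ := by
    intro m
    induction m with
    | zero => exact le_rfl
    | succ m ih =>
      rw [Function.iterate_succ_apply']
      exact (BoundedContinuousFunction.norm_ofNormedAddCommGroup_le _ (norm_nonneg _) _).trans ih
  have h1 : Tendsto (fun m => ∫ x, (markovOp Ψ ν hΨ hc)^[m] φ x ∂(π' : Measure V)) atTop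
      (𝓝 (∫ x, (∫ y, φ y ∂(π : Measure V)) ∂(π' : Measure V))) := by
    refine tendsto_integral_of_dominated_convergence (fun _ => ‖φ‖)
      (fun m => (BoundedContinuousFunction.continuous _).measurable.aestronglyMeasurable)
      (integrable_const _)
      (fun m => ae_of_all _ fun x => (BoundedContinuousFunction.norm_coe_le_norm _ _).trans
        (hbound m)) (ae_of_all _ fun x => ?_)
    rw [tendsto_iff_norm_sub_tendsto_zero]
    refine squeeze_zero (fun _ => norm_nonneg _)
      (fun m => abs_iterate_sub_integral_le hr hπ hi hφ m x) ?_
    have := ((tendsto_pow_atTop_nhds_zero_of_lt_one r.2 hr1').const_mul (K : ℝ)).mul_const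
      (∫ y, ‖x - y‖ ∂(π : Measure V))
    simpa using this
  simp_rw [integral_iterate_markovOp hπ'] at h1
  simpa using tendsto_nhds_unique tendsto_const_nhds h1

end Markov

/-! ### Strongly monotone maps and the implicit step. -/

section Monotone

variable {V : Type*} [NormedAddCommGroup V] [InnerProductSpace ℝ V]

/-- Cauchy–Schwarz, then cancel one factor `‖x - y‖`. This yields both injectivity and the Lipschitz
bound of the inverse. -/
lemma norm_sub_le_of_strongly_monotone {Φ : V → V} {c : ℝ}
    (hm : ∀ x y, c * ‖x - y‖ ^ 2 ≤ inner ℝ (Φ x - Φ y) (x - y)) (x y : V) :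
    c * ‖x - y‖ ≤ ‖Φ x - Φ y‖ := by
  rcases (norm_nonneg (x - y)).eq_or_lt with h | h
  · rw [← h]; simp
  · have := (hm x y).trans (real_inner_le_norm _ _)
    nlinarith

/-- A strongly monotone map of a Hilbert space which is Lipschitz on balls is onto: for small steps,
`y ↦ y - ρ (Φ y - b)` is a contraction of a large ball. -/
theorem surjective_of_strongly_monotone [CompleteSpace V] {Φ : V → V} {c : ℝ} (hc : 0 < c)
    (hm : ∀ x y, c * ‖x - y‖ ^ 2 ≤ inner ℝ (Φ x - Φ y) (x - y))
    (hL : ∀ R : ℝ, ∃ L : ℝ, ∀ x y, ‖x‖ ≤ R → ‖y‖ ≤ R → ‖Φ x - Φ y‖ ≤ L * ‖x - y‖) :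
    Function.Surjective Φ := by
  intro b
  -- A solution has norm at most `‖Φ 0 - b‖ / c`. With the factor 2, `‖T 0‖ = (ρ c / 2) R`, exactly
  -- what the contraction factor `1 - ρ c / 2` leaves over, so `T` preserves the ball.
  set R : ℝ := 2 * ‖Φ 0 - b‖ / c with hR
  have hR0 : 0 ≤ R := by positivity
  obtain ⟨L', hL'⟩ := hL R
  -- Enlarging the Lipschitz constant to at least `c` makes it positive and ensures `ρ c ≤ 1`.
  set L : ℝ := max L' c with hLdef
  have hLc : c ≤ L := le_max_right _ _
  have hL0 : 0 < L := hc.trans_le hLc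
  have hLip : ∀ x y, ‖x‖ ≤ R → ‖y‖ ≤ R → ‖Φ x - Φ y‖ ≤ L * ‖x - y‖ := fun x y hx hy =>
    (hL' x y hx hy).trans (mul_le_mul_of_nonneg_right (le_max_left _ _) (norm_nonneg _))
  -- The minimiser of `1 - 2 ρ c + ρ² L²`. The minimum is `1 - ρ c`, which is at most `(1 - ρ c /
  -- 2)²`.
  set ρ : ℝ := c / L ^ 2 with hρ
  have hρ0 : 0 < ρ := by positivity
  have hρc : ρ * c ≤ 1 := by
    rw [hρ, div_mul_eq_mul_div, div_le_one (by positivity)]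
    nlinarith
  have hρL : ρ * L ^ 2 = c := by rw [hρ]; field_simp
  set T : V → V := fun y => y - ρ • (Φ y - b) with hT
  have hk0 : 0 ≤ 1 - ρ * c / 2 := by linarith
  have hTlip : ∀ x y, ‖x‖ ≤ R → ‖y‖ ≤ R → ‖T x - T y‖ ≤ (1 - ρ * c / 2) * ‖x - y‖ := by
    intro x y hx hy
    have e1 : T x - T y = (x - y) - ρ • (Φ x - Φ y) := by
      simp only [hT, smul_sub]; abel
    have e2 : ‖T x - T y‖ ^ 2 ≤ ((1 - ρ * c / 2) * ‖x - y‖) ^ 2 := by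
      rw [e1, norm_sub_sq_real, inner_smul_right, norm_smul, mul_pow, Real.norm_of_nonneg hρ0.le,
        real_inner_comm]
      have h1 := hm x y
      have h2 : ‖Φ x - Φ y‖ ^ 2 ≤ L ^ 2 * ‖x - y‖ ^ 2 := by
        rw [← mul_pow]
        exact pow_le_pow_left₀ (norm_nonneg _) (hLip x y hx hy) 2
      have h3 : ρ ^ 2 * ‖Φ x - Φ y‖ ^ 2 ≤ ρ * c * ‖x - y‖ ^ 2 :=
        calc ρ ^ 2 * ‖Φ x - Φ y‖ ^ 2 ≤ ρ ^ 2 * (L ^ 2 * ‖x - y‖ ^ 2) := by gcongr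
          _ = ρ * (ρ * L ^ 2) * ‖x - y‖ ^ 2 := by ring
          _ = ρ * c * ‖x - y‖ ^ 2 := by rw [hρL]
      have h4 := mul_le_mul_of_nonneg_left h1 hρ0.le
      nlinarith [sq_nonneg (ρ * c / 2 * ‖x - y‖)]
    exact (pow_le_pow_iff_left₀ (norm_nonneg _) (mul_nonneg hk0 (norm_nonneg _)) two_ne_zero).1 e2
  have hmaps : Set.MapsTo T (Metric.closedBall 0 R) (Metric.closedBall 0 R) := by
    intro y hy
    rw [mem_closedBall_zero_iff] at hy ⊢
    have h1 := hTlip y 0 hy (by simpa using hR0)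
    have h2 : ‖T 0‖ = ρ * ‖Φ 0 - b‖ := by
      simp [hT, norm_smul, abs_of_pos hρ0]
    have h3 : ‖Φ 0 - b‖ = R * c / 2 := by rw [hR]; field_simp
    have h4 : ‖T y‖ ≤ ‖T y - T 0‖ + ‖T 0‖ := by simpa using norm_add_le (T y - T 0) (T 0)
    rw [sub_zero] at h1
    have h5 : (1 - ρ * c / 2) * ‖y‖ ≤ (1 - ρ * c / 2) * R := mul_le_mul_of_nonneg_left hy hk0
    rw [h2, h3] at h4
    linarith
  have hcontr : ContractingWith ⟨1 - ρ * c / 2, hk0⟩ (hmaps.restrict T _ _) := by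
    refine ⟨?_, LipschitzWith.of_dist_le_mul fun x y => ?_⟩
    · have := mul_pos hρ0 hc
      exact NNReal.coe_lt_coe.1 (show 1 - ρ * c / 2 < 1 by linarith)
    · have := hTlip x y (mem_closedBall_zero_iff.1 x.2) (mem_closedBall_zero_iff.1 y.2)
      rw [Subtype.dist_eq, Subtype.dist_eq, dist_eq_norm, dist_eq_norm]
      exact this
  obtain ⟨y, -, hy, -⟩ := hcontr.exists_fixedPoint' Metric.isClosed_closedBall.isComplete hmaps
    (x := 0) (by simpa using hR0) (edist_ne_top _ _)
  refine ⟨y, ?_⟩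
  have h1 : y - ρ • (Φ y - b) = y := hy
  rw [sub_eq_self, smul_eq_zero] at h1
  exact sub_eq_zero.1 (h1.resolve_left hρ0.ne')

/-- The map `y ↦ y - τ A y - τ F(y)` which has to be inverted in a step of an implicit scheme. -/
def implicitMap (A : V →ₗ[ℝ] V) (F : V → V) (τ : ℝ) (y : V) : V := y - τ • A y - τ • F y

lemma implicitMap_sub (A : V →ₗ[ℝ] V) (F : V → V) (τ : ℝ) (x y : V) :
    implicitMap A F τ x - implicitMap A F τ y =
      (x - y) - τ • A (x - y) - τ • (F x - F y) := by
  simp only [implicitMap, map_sub, smul_sub]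
  abel

/-- The implicit step is uniquely solvable, with a Lipschitz continuous solution map. -/
theorem exists_resolvent [FiniteDimensional ℝ V] {A : V →ₗ[ℝ] V} {F : V → V} {τ lam L : ℝ}
    (hτ : 0 ≤ τ) (hL : L ≤ lam) (hA : ∀ x, inner ℝ x (A x) ≤ -(lam * ‖x‖ ^ 2))
    (hF : ∀ x y, inner ℝ (x - y) (F x - F y) ≤ L * ‖x - y‖ ^ 2)
    (hF' : ∀ R : ℝ, ∃ K : ℝ, ∀ x y, ‖x‖ ≤ R → ‖y‖ ≤ R → ‖F x - F y‖ ≤ K * ‖x - y‖) :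
    ∃ S : V → V, (∀ y b, implicitMap A F τ y = b ↔ y = S b) ∧
      ∀ b c, (1 + τ * (lam - L)) * ‖S b - S c‖ ≤ ‖b - c‖ := by
  have : CompleteSpace V := FiniteDimensional.complete ℝ _
  have hc : 0 < 1 + τ * (lam - L) := by
    have := mul_nonneg hτ (sub_nonneg.2 hL)
    linarith
  have hm : ∀ x y, (1 + τ * (lam - L)) * ‖x - y‖ ^ 2 ≤
      inner ℝ (implicitMap A F τ x - implicitMap A F τ y) (x - y) := by
    intro x y
    rw [real_inner_comm, implicitMap_sub, inner_sub_right, inner_sub_right, inner_smul_right,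
      inner_smul_right, real_inner_self_eq_norm_sq]
    have h1 := mul_le_mul_of_nonneg_left (hA (x - y)) hτ
    have h2 := mul_le_mul_of_nonneg_left (hF x y) hτ
    linarith
  have hlip : ∀ R : ℝ, ∃ K : ℝ, ∀ x y, ‖x‖ ≤ R → ‖y‖ ≤ R →
      ‖implicitMap A F τ x - implicitMap A F τ y‖ ≤ K * ‖x - y‖ := by
    intro R
    obtain ⟨K, hK⟩ := hF' R
    refine ⟨1 + τ * ‖A.toContinuousLinearMap‖ + τ * K, fun x y hx hy => ?_⟩
    have h1 := mul_le_mul_of_nonneg_left (hK x y hx hy) hτ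
    have h2 := mul_le_mul_of_nonneg_left (A.toContinuousLinearMap.le_opNorm (x - y)) hτ
    rw [LinearMap.coe_toContinuousLinearMap'] at h2
    rw [implicitMap_sub]
    have h3 := norm_sub_le ((x - y) - τ • A (x - y)) (τ • (F x - F y))
    have h4 := norm_sub_le (x - y) (τ • A (x - y))
    rw [norm_smul, Real.norm_of_nonneg hτ] at h3 h4
    linarith
  have hs := surjective_of_strongly_monotone hc hm hlip
  have hi : Function.Injective (implicitMap A F τ) := by
    intro x y hxy
    have := norm_sub_le_of_strongly_monotone hm x y
    rw [hxy, sub_self, norm_zero] at this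
    have h0 : ‖x - y‖ = 0 := le_antisymm (by nlinarith) (norm_nonneg _)
    exact sub_eq_zero.1 (norm_eq_zero.1 h0)
  refine ⟨Function.surjInv hs, fun y b => ⟨?_, ?_⟩, fun b c => ?_⟩
  · rintro rfl
    exact hi (Function.surjInv_eq hs _).symm
  · rintro rfl
    exact Function.surjInv_eq hs _
  · have := norm_sub_le_of_strongly_monotone hm (Function.surjInv hs b) (Function.surjInv hs c)
    rwa [Function.surjInv_eq hs b, Function.surjInv_eq hs c] at this

/-- A family of bounded linear operators, given by their values, which is Lipschitz continuous in
the parameter. -/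
lemma exists_continuous_clm {H : Type*} [NormedAddCommGroup H] [InnerProductSpace ℝ H]
    {T : V → H → V} (hadd : ∀ x u v, T x (u + v) = T x u + T x v)
    (hsmul : ∀ (x : V) (a : ℝ) (u : H), T x (a • u) = a • T x u)
    (hb : ∀ x, ∃ c : ℝ, ∀ u, ‖T x u‖ ≤ c * ‖u‖) {K : ℝ} (hK0 : 0 ≤ K)
    (hK : ∀ x y u, ‖T x u - T y u‖ ≤ K * ‖x - y‖ * ‖u‖) :
    ∃ N : V → H →L[ℝ] V, (∀ x u, N x u = T x u) ∧ Continuous N := by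
  choose c hc using hb
  refine ⟨fun x => LinearMap.mkContinuous
    { toFun := T x, map_add' := hadd x, map_smul' := hsmul x } (c x) (hc x), fun _ _ => rfl, ?_⟩
  refine LipschitzWith.continuous (K := ⟨K, hK0⟩) (LipschitzWith.of_dist_le_mul fun x y => ?_)
  rw [dist_eq_norm, dist_eq_norm]
  exact ContinuousLinearMap.opNorm_le_bound _ (by positivity) fun u => hK x y u

end Monotone

/-! ### Second moments and uniqueness of Gaussian laws on a Hilbert space. -/

section Gaussian

variable {H : Type*} [NormedAddCommGroup H] [InnerProductSpace ℝ H]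

lemma hasSum_inner_covariance (Q : H →L[ℝ] H) (e : HilbertBasis ℕ ℝ H) {lam : ℕ → ℝ}
    (hQ : ∀ k, Q (e k) = lam k • e k) (u : H) :
    HasSum (fun k => lam k * inner ℝ (e k) u ^ 2) (inner ℝ (Q u) u) := by
  have h1 := (e.hasSum_repr u).mapL Q
  have h2 := h1.mapL (innerSL ℝ u)
  simp only [innerSL_apply_apply] at h2
  rw [real_inner_comm]
  have h3 : (fun k => lam k * inner ℝ (e k) u ^ 2) =
      fun k => inner ℝ u (Q (e.repr u k • e k)) := by
    funext k
    rw [map_smul, hQ, inner_smul_right, inner_smul_right, e.repr_apply_apply, real_inner_comm]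
    ring
  rw [h3]
  exact h2

variable [MeasurableSpace H] [BorelSpace H]

/-- Cramér–Wold: the characteristic function at `u` depends only on the law of `⟨w, u⟩`. -/
lemma eq_of_gaussian_marginals [CompleteSpace H] [SecondCountableTopology H]
    {μ ν : Measure H} [IsFiniteMeasure μ] [IsFiniteMeasure ν]
    (hμν : ∀ u, μ.map (fun w => inner ℝ w u) = ν.map (fun w => inner ℝ w u)) : μ = ν := by
  refine Measure.ext_of_charFun (funext fun u => ?_)
  have key : ∀ μ : Measure H, charFun μ u =
      ∫ s : ℝ, Complex.exp (s * Complex.I) ∂(μ.map (fun w => inner ℝ w u)) := by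
    intro μ
    rw [charFun_apply, integral_map (by fun_prop) (by fun_prop)]
  rw [key, key, hμν]

variable {ν : Measure H} {Q : H →L[ℝ] H} {t : ℝ≥0}

/-- Expand the square: the mean is zero, so the cross term drops out and only the variance remains.
-/
lemma lintegral_add_inner_sq (hν : ∀ u, ν.map (fun w => inner ℝ w u) =
      gaussianReal 0 (t * (inner ℝ (Q u) u).toNNReal)) (a : ℝ) (u : H) :
    ∫⁻ w, ENNReal.ofReal ((a + inner ℝ w u) ^ 2) ∂ν =
      ENNReal.ofReal (a ^ 2) + t * ENNReal.ofReal (inner ℝ (Q u) u) := by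
  set v : ℝ≥0 := t * (inner ℝ (Q u) u).toNNReal with hv
  have h1 : ∫⁻ w, ENNReal.ofReal ((a + inner ℝ w u) ^ 2) ∂ν =
      ∫⁻ s, ENNReal.ofReal ((a + s) ^ 2) ∂(gaussianReal 0 v) := by
    rw [← hν, lintegral_map (by fun_prop) (by fun_prop)]
  have hL : MemLp id 2 (gaussianReal 0 v) := memLp_id_gaussianReal 2
  have hi1 : Integrable (fun s : ℝ => s) (gaussianReal 0 v) := hL.integrable (by norm_num)
  have hi2 : Integrable (fun s : ℝ => s ^ 2) (gaussianReal 0 v) := hL.integrable_sq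
  have hm1 : ∫ s, s ∂(gaussianReal 0 v) = 0 := integral_id_gaussianReal
  have hm2 : ∫ s, s ^ 2 ∂(gaussianReal 0 v) = v := by
    have := variance_of_integral_eq_zero (X := id) (μ := gaussianReal 0 v)
      measurable_id.aemeasurable hm1
    rw [variance_id_gaussianReal] at this
    exact this.symm
  have hexp : (fun s : ℝ => (a + s) ^ 2) = fun s => (a ^ 2 + 2 * a * s) + s ^ 2 := by
    funext s; ring
  have hi3 : Integrable (fun s : ℝ => a ^ 2 + 2 * a * s) (gaussianReal 0 v) :=
    (integrable_const _).add (hi1.const_mul _)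
  rw [h1, ← ofReal_integral_eq_lintegral_ofReal (by rw [hexp]; exact hi3.add hi2)
    (ae_of_all _ fun s => sq_nonneg _), hexp, integral_add hi3 hi2,
    integral_add (integrable_const _) (hi1.const_mul _), integral_const_mul, hm1, hm2]
  simp only [integral_const, probReal_univ, one_smul, mul_zero, add_zero]
  rw [ENNReal.ofReal_add (sq_nonneg _) v.coe_nonneg, hv, ENNReal.ofReal_coe_nnreal, ENNReal.coe_mul]
  rfl

/-- The second moment of an affine image, in a finite dimensional space, of a centred Gaussian
measure. -/
lemma lintegral_affine_sq [CompleteSpace H] {V : Type*} [NormedAddCommGroup V] [InnerProductSpace ℝ V]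
    [FiniteDimensional ℝ V] (e : HilbertBasis ℕ ℝ H) {lam : ℕ → ℝ} (hlam : ∀ k, 0 ≤ lam k)
    (hQ : ∀ k, Q (e k) = lam k • e k) (hν : ∀ u, ν.map (fun w => inner ℝ w u) =
      gaussianReal 0 (t * (inner ℝ (Q u) u).toNNReal)) (c : V) (D : H →L[ℝ] V) :
    ∫⁻ w, ‖c + D w‖ₑ ^ 2 ∂ν = ‖c‖ₑ ^ 2 + t * ∑' k, ENNReal.ofReal (lam k) * ‖D (e k)‖ₑ ^ 2 := by
  have : CompleteSpace V := FiniteDimensional.complete ℝ V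
  let b := stdOrthonormalBasis ℝ V
  have hn : ∀ x : V, ‖x‖ₑ ^ 2 = ∑ j, ENNReal.ofReal (inner ℝ (b j) x ^ 2) := by
    intro x
    rw [← ENNReal.ofReal_sum_of_nonneg (fun _ _ => sq_nonneg _), ← ofReal_norm,
      ← ENNReal.ofReal_pow (norm_nonneg _), ← b.sum_sq_norm_inner_right x]
    simp
  -- The adjoint turns each coordinate of `D w` into a scalar marginal of `w`. Parseval in `V` then
  -- reassembles the Hilbert–Schmidt sum.
  have hadj : ∀ j w, inner ℝ (b j) (D w) = inner ℝ w (ContinuousLinearMap.adjoint D (b j)) := by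
    intro j w
    rw [ContinuousLinearMap.adjoint_inner_right, real_inner_comm]
  have hq : ∀ u, ENNReal.ofReal (inner ℝ (Q u) u) =
      ∑' k, ENNReal.ofReal (lam k) * ENNReal.ofReal (inner ℝ (e k) u ^ 2) := by
    intro u
    have hs := hasSum_inner_covariance Q e hQ u
    rw [← hs.tsum_eq, ENNReal.ofReal_tsum_of_nonneg
      (fun k => mul_nonneg (hlam k) (sq_nonneg _)) hs.summable]
    exact tsum_congr fun k => ENNReal.ofReal_mul (hlam k)
  simp_rw [hn, inner_add_right, hadj]
  rw [lintegral_finsetSum _ (fun j _ => by fun_prop)]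
  simp_rw [lintegral_add_inner_sq hν, hq, Finset.sum_add_distrib, Finset.mul_sum]
  rw [Summable.tsum_finsetSum (fun _ _ => ENNReal.summable), Finset.mul_sum]

end Gaussian

variable {d : ℕ} {O : TopologicalSpace.Opens (E d)} {h : ℝ}

/-! ### The discretised coefficients on `V_h`. -/

section FiniteElements

/-- Lebesgue measure on `𝒪`. -/
local notation "μO" O => (volume.restrict (SetLike.coe O) : Measure (E _))

lemma exists_ae_abs_le (hOb : Bornology.IsBounded (O : Set (E d))) (𝒯 : Partition O h)
    (u : Vh 𝒯) : ∃ C : ℝ, ∀ᵐ ξ ∂(μO O), |(u : L2 O) ξ| ≤ C := by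
  obtain ⟨-, v, a, hv, huv⟩ := u.2
  obtain ⟨C, hC⟩ := hOb.isCompact_closure.exists_bound_of_continuousOn hv.1
  refine ⟨C, ?_⟩
  filter_upwards [huv, ae_restrict_mem O.isOpen.measurableSet] with ξ h1 h2
  rw [h1]
  exact hC ξ (subset_closure h2)

lemma coeFn_sum_smul {ι : Type*} [Fintype ι] (b : ι → L2 O) (c : ι → ℝ) :
    ((∑ i, c i • b i : L2 O) : E d → ℝ) =ᵐ[μO O] fun ξ => ∑ i, c i * b i ξ := by
  have h1 := Lp.coeFn_finsetSum (p := 2) (μ := μO O) Finset.univ fun i => c i • b i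
  have h2 : ∀ᵐ ξ ∂(μO O), ∀ i, (c i • b i : L2 O) ξ = c i * b i ξ :=
    ae_all_iff.2 fun i => by
      filter_upwards [Lp.coeFn_smul (c i) (b i)] with ξ hξ
      rw [hξ, Pi.smul_apply, smul_eq_mul]
  filter_upwards [h1, h2] with ξ h3 h4
  rw [h3]
  simp [h4]

/-- On the finite dimensional space `V_h` the uniform norm is controlled by the norm of `L²`. -/
lemma exists_ae_abs_le_mul_norm (hOb : Bornology.IsBounded (O : Set (E d))) (𝒯 : Partition O h) :
    ∃ C : ℝ, 0 ≤ C ∧ ∀ u : Vh 𝒯, ∀ᵐ ξ ∂(μO O), |(u : L2 O) ξ| ≤ C * ‖u‖ := by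
  obtain ⟨ι, _, ⟨b⟩⟩ : ∃ (ι : Type) (_ : Fintype ι), Nonempty (OrthonormalBasis ι ℝ (Vh 𝒯)) :=
    ⟨_, _, ⟨stdOrthonormalBasis ℝ (Vh 𝒯)⟩⟩
  choose C hC using fun i => exists_ae_abs_le hOb 𝒯 (b i)
  -- Each coordinate in an orthonormal basis is at most `‖u‖`, so the sup bounds of the basis
  -- functions add up.
  refine ⟨∑ i, |C i|, by positivity, fun u => ?_⟩
  have h1 : (u : L2 O) = ∑ i, (inner ℝ (b i) u : ℝ) • (b i : L2 O) := by
    have := congrArg (Vh 𝒯).subtype (b.sum_repr' u)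
    rw [map_sum] at this
    exact this.symm
  have h2 := coeFn_sum_smul (fun i => (b i : L2 O)) fun i => (inner ℝ (b i) u : ℝ)
  rw [← h1] at h2
  filter_upwards [h2, ae_all_iff.2 hC] with ξ h3 h4
  rw [h3, Finset.sum_mul]
  refine (Finset.abs_sum_le_sum_abs _ _).trans (Finset.sum_le_sum fun i _ => ?_)
  rw [abs_mul, mul_comm]
  have h5 : |(inner ℝ (b i) u : ℝ)| ≤ ‖u‖ := by
    have := abs_real_inner_le_norm (b i) u
    rwa [b.norm_eq_one, one_mul] at this
  exact mul_le_mul ((h4 i).trans (le_abs_self _)) h5 (abs_nonneg _) (abs_nonneg _)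

lemma inner_eq_integral (u v : L2 O) : inner ℝ u v = ∫ ξ, u ξ * v ξ ∂(μO O) := by
  rw [L2.inner_def]
  refine integral_congr_ae (ae_of_all _ fun ξ => ?_)
  simp [mul_comm]

lemma norm_sq_eq_integral (u : L2 O) : ‖u‖ ^ 2 = ∫ ξ, u ξ ^ 2 ∂(μO O) := by
  rw [← real_inner_self_eq_norm_sq, inner_eq_integral]
  simp_rw [sq]

lemma enorm_toLp_sq {w : E d → ℝ} (hw : MemLp w 2 (μO O)) :
    ‖hw.toLp w‖ₑ ^ 2 = ∫⁻ ξ, ‖w ξ‖ₑ ^ 2 ∂(μO O) := by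
  rw [Lp.enorm_toLp]
  have := eLpNorm_nnreal_pow_eq_lintegral (f := w) (μ := μO O) (p := 2) (by norm_num)
  simpa using this

lemma integrable_mul_Lp {w : E d → ℝ} (hw : MemLp w 2 (μO O)) (v : L2 O) :
    Integrable (fun ξ => w ξ * v ξ) (μO O) :=
  hw.integrable_mul (Lp.memLp v)

/-- The `L²` inner product with `w` witnesses that the defining property is satisfiable, so the
chosen functional has it and the default value zero does not occur. -/
lemma toHm1_apply {w : E d → ℝ} (hw : MemLp w 2 (μO O)) (v : H10 O) :
    (toHm1 O w : Module.Dual ℝ (H10 O)) v = ∫ ξ, w ξ * (v : L2 O) ξ ∂(μO O) := by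
  have hex : ∃ z : Hm1 O, ∀ v : H10 O,
      Integrable (fun ξ => w ξ * (v : L2 O) ξ) (volume.restrict (O : Set (E d))) ∧
      (z : Module.Dual ℝ (H10 O)) v = ∫ ξ in (O : Set (E d)), w ξ * (v : L2 O) ξ := by
    refine ⟨⟨((innerₗ (L2 O)) (hw.toLp w)).comp (H10 O).subtype, ‖hw.toLp w‖, fun v => ?_⟩,
      fun v => ⟨integrable_mul_Lp hw v, ?_⟩⟩
    · refine (abs_real_inner_le_norm (hw.toLp w) (v : L2 O)).trans ?_
      gcongr
      exact le_add_of_nonneg_right (norm_nonneg _)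
    · change inner ℝ (hw.toLp w) (v : L2 O) = _
      rw [inner_eq_integral]
      refine integral_congr_ae ?_
      filter_upwards [hw.coeFn_toLp] with ξ hξ
      rw [hξ]
  rw [toHm1, dif_pos hex]
  exact (hex.choose_spec v).2

variable (𝒯 : Partition O h)

lemma inner_Ph_toHm1 {w : E d → ℝ} (hw : MemLp w 2 (μO O)) (v : Vh 𝒯) :
    inner ℝ v (Ph 𝒯 (toHm1 O w)) = ∫ ξ, w ξ * (v : L2 O) ξ ∂(μO O) := by
  rw [inner_Ph, toHm1_apply hw]
  rfl

/-- Both sides have the same inner products with `V_h`. Linearity and nonexpansiveness of `𝒫_h` on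
`L²` are inherited from the orthogonal projection. -/
lemma Ph_toHm1 {w : E d → ℝ} (hw : MemLp w 2 (μO O)) :
    Ph 𝒯 (toHm1 O w) = (Vh 𝒯).orthogonalProjectionOnto (hw.toLp w) := by
  refine ext_inner_left ℝ fun v => ?_
  rw [inner_Ph_toHm1 𝒯 hw, Submodule.inner_orthogonalProjectionOnto_eq_of_mem_left, inner_eq_integral]
  refine integral_congr_ae ?_
  filter_upwards [hw.coeFn_toLp] with ξ hξ
  rw [hξ, mul_comm]

lemma Ph_toHm1_coe (x : L2 O) : Ph 𝒯 (toHm1 O x) = (Vh 𝒯).orthogonalProjectionOnto x := by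
  rw [Ph_toHm1 𝒯 (Lp.memLp x), Lp.toLp_coeFn]

lemma norm_Ph_toHm1_le {w : E d → ℝ} (hw : MemLp w 2 (μO O)) :
    ‖Ph 𝒯 (toHm1 O w)‖ ≤ ‖hw.toLp w‖ := by
  rw [Ph_toHm1 𝒯 hw]
  exact Submodule.norm_orthogonalProjectionOnto_apply_le _ _

lemma Ph_toHm1_sub {w w' : E d → ℝ} (hw : MemLp w 2 (μO O)) (hw' : MemLp w' 2 (μO O)) :
    Ph 𝒯 (toHm1 O w) - Ph 𝒯 (toHm1 O w') = Ph 𝒯 (toHm1 O (w - w')) := by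
  have e3 : Ph 𝒯 (toHm1 O (w - w')) = (Vh 𝒯).orthogonalProjectionOnto (hw.toLp w - hw'.toLp w') :=
    Ph_toHm1 𝒯 (hw.sub hw')
  exact (congrArg₂ (· - ·) (Ph_toHm1 𝒯 hw) (Ph_toHm1 𝒯 hw')).trans
    ((map_sub (Vh 𝒯).orthogonalProjectionOnto (hw.toLp w) (hw'.toLp w')).symm.trans e3.symm)

lemma Ph_toHm1_add {w w' : E d → ℝ} (hw : MemLp w 2 (μO O)) (hw' : MemLp w' 2 (μO O)) :
    Ph 𝒯 (toHm1 O (w + w')) = Ph 𝒯 (toHm1 O w) + Ph 𝒯 (toHm1 O w') := by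
  have e3 : Ph 𝒯 (toHm1 O (w + w')) = (Vh 𝒯).orthogonalProjectionOnto (hw.toLp w + hw'.toLp w') :=
    Ph_toHm1 𝒯 (hw.add hw')
  exact e3.trans ((map_add (Vh 𝒯).orthogonalProjectionOnto (hw.toLp w) (hw'.toLp w')).trans
    (congrArg₂ (· + ·) (Ph_toHm1 𝒯 hw) (Ph_toHm1 𝒯 hw')).symm)

lemma Ph_toHm1_const_smul {w : E d → ℝ} (hw : MemLp w 2 (μO O)) (c : ℝ) :
    Ph 𝒯 (toHm1 O (c • w)) = c • Ph 𝒯 (toHm1 O w) := by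
  have e3 : Ph 𝒯 (toHm1 O (c • w)) = (Vh 𝒯).orthogonalProjectionOnto (c • hw.toLp w) :=
    Ph_toHm1 𝒯 (hw.const_smul c)
  exact e3.trans ((map_smul (Vh 𝒯).orthogonalProjectionOnto c (hw.toLp w)).trans
    (congrArg (c • ·) (Ph_toHm1 𝒯 hw)).symm)

lemma Ph_toHm1_congr {w w' : E d → ℝ} (hw : MemLp w 2 (μO O)) (hw' : MemLp w' 2 (μO O))
    (hww' : w =ᵐ[μO O] w') : Ph 𝒯 (toHm1 O w) = Ph 𝒯 (toHm1 O w') :=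
  (Ph_toHm1 𝒯 hw).trans ((congrArg _ (MemLp.toLp_congr hw hw' hww')).trans (Ph_toHm1 𝒯 hw').symm)

lemma enorm_Ph_toHm1_sq_le {w : E d → ℝ} (hw : MemLp w 2 (μO O)) :
    ‖Ph 𝒯 (toHm1 O w)‖ₑ ^ 2 ≤ ∫⁻ ξ, ‖w ξ‖ₑ ^ 2 ∂(μO O) := by
  rw [← enorm_toLp_sq hw]
  gcongr
  exact enorm_le_iff_norm_le.2 (norm_Ph_toHm1_le 𝒯 hw)

/-- A function dominated by a multiple of `u` has a small projection on `V_h`. -/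
lemma norm_Ph_toHm1_le_mul {w : E d → ℝ} (hw : MemLp w 2 (μO O)) {c : ℝ} {u : L2 O}
    (hwu : ∀ᵐ ξ ∂(μO O), |w ξ| ≤ c * |u ξ|) : ‖Ph 𝒯 (toHm1 O w)‖ ≤ c * ‖u‖ := by
  refine (norm_Ph_toHm1_le 𝒯 hw).trans (Lp.norm_le_mul_norm_of_ae_le_mul ?_)
  filter_upwards [hw.coeFn_toLp, hwu] with ξ h1 h2
  rw [h1]
  exact h2

/-- The Rayleigh quotients are bounded below by zero, so the real infimum is a genuine lower bound.
-/
lemma firstEigenvalue_mul_le (u : H10 O) :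
    firstEigenvalue O * ‖(u : L2 O)‖ ^ 2 ≤ ‖grad O u‖ ^ 2 := by
  rcases eq_or_ne u 0 with rfl | hu
  · simp
  · have h0 : 0 < ‖(u : L2 O)‖ ^ 2 := by
      have : (u : L2 O) ≠ 0 := fun h' => hu (Subtype.ext h')
      positivity
    rw [← le_div_iff₀ h0]
    refine csInf_le ⟨0, ?_⟩ ⟨u, hu, rfl⟩
    rintro _ ⟨v, -, rfl⟩
    positivity

lemma inner_Ah_self_le (x : Vh 𝒯) : inner ℝ x (Ah 𝒯 x) ≤ -(firstEigenvalue O * ‖x‖ ^ 2) := by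
  rw [inner_Ah, real_inner_self_eq_norm_sq, neg_le_neg_iff]
  exact firstEigenvalue_mul_le (Submodule.inclusion (Vh_le 𝒯) x)

/-- Mean value inequality, with the polynomial bound on `f'` evaluated at the end of the interval;
`q ≥ 1` makes the power monotone. -/
lemma DriftAssumption.exists_lipschitzOn {f : ℝ → ℝ} {q L₁ L₂ L₃ L₄ L₅ : ℝ}
    (hf : DriftAssumption d f q L₁ L₂ L₃ L₄ L₅) (R : ℝ) :
    ∃ K : ℝ, 0 ≤ K ∧ ∀ ξ η, |ξ| ≤ R → |η| ≤ R → |f ξ - f η| ≤ K * |ξ - η| := by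
  refine ⟨|L₄| * |R| ^ (q - 1) + |L₅|, by positivity, fun ξ η hξ hη => ?_⟩
  have := Convex.norm_image_sub_le_of_norm_deriv_le (𝕜 := ℝ) (f := f) (s := Set.Icc (-R) R)
    (C := |L₄| * |R| ^ (q - 1) + |L₅|) (x := η) (y := ξ)
    (fun x _ => hf.differentiable x) ?_ (convex_Icc _ _) (abs_le.1 hη) (abs_le.1 hξ)
  · simpa using this
  · intro x hx
    have hx' : |x| ≤ |R| := (abs_le.2 hx).trans (le_abs_self R)
    refine (hf.growth x).trans (add_le_add ?_ (le_abs_self _))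
    refine mul_le_mul (le_abs_self _) ?_ (by positivity) (abs_nonneg _)
    exact Real.rpow_le_rpow (abs_nonneg _) hx' (by linarith [hf.one_le])

/-- Since `G` is Lipschitz continuous on constant functions, `g` is Lipschitz continuous. -/
lemma DiffusionAssumption.exists_lipschitz (hOb : Bornology.IsBounded (O : Set (E d)))
    {e : HilbertBasis ℕ ℝ (L2 O)} {lam : ℕ → ℝ} (hlam : ∀ k, 0 < lam k) {g : ℝ → ℝ}
    {L₆ L₇ L₈ : ℝ} (hg : DiffusionAssumption e lam g L₆ L₇ L₈) :
    ∃ K : ℝ≥0, LipschitzWith K g := by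
  have : IsFiniteMeasure (μO O) := ⟨by simpa using hOb.measure_lt_top⟩
  obtain ⟨C, hC0, hC⟩ : ∃ C : ℝ, 0 ≤ C ∧ ∀ c : ℝ,
      ‖(memLp_const c : MemLp (fun _ => c) 2 (μO O)).toLp _‖ ≤ C * |c| := by
    refine ⟨‖(memLp_const (1 : ℝ) : MemLp (fun _ => (1 : ℝ)) 2 (μO O)).toLp _‖,
      norm_nonneg _, fun c => ?_⟩
    rw [mul_comm]
    refine Lp.norm_le_mul_norm_of_ae_le_mul ?_
    filter_upwards [(memLp_const c : MemLp (fun _ => c) 2 (μO O)).coeFn_toLp,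
      (memLp_const (1 : ℝ) : MemLp (fun _ => (1 : ℝ)) 2 (μO O)).coeFn_toLp] with ξ h1 h2
    rw [h1, h2]
    simp
  -- Testing on constants `a`, `b` and keeping only the term `k = 0` of the Hilbert–Schmidt sum
  -- gives `lam 0 * |g a - g b|² ≤ L₆ (C |a - b|)²`, because `e 0` has unit norm.
  refine ⟨⟨√(L₆ / lam 0) * C, by positivity⟩, LipschitzWith.of_dist_le_mul fun a b => ?_⟩
  rw [Real.dist_eq, Real.dist_eq]
  change _ ≤ √(L₆ / lam 0) * C * |a - b|
  set x := (memLp_const a : MemLp (fun _ => a) 2 (μO O)).toLp _ with hx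
  set y := (memLp_const b : MemLp (fun _ => b) 2 (μO O)).toLp _ with hy
  have hxy : ‖x - y‖ ≤ C * |a - b| := by
    have := hC (a - b)
    rwa [show (memLp_const (a - b) : MemLp (fun _ => a - b) 2 (μO O)).toLp _ = x - y from
      MemLp.toLp_sub _ _] at this
  have h1 : ENNReal.ofReal (lam 0) *
      ∫⁻ ξ, ‖(nemG g x (e 0) - nemG g y (e 0)) ξ‖ₑ ^ 2 ∂(μO O) ≤
      ENNReal.ofReal (L₆ * ‖x - y‖ ^ 2) := by
    refine le_trans ?_ (hg.lip x y)
    exact ENNReal.le_tsum (f := fun k => ENNReal.ofReal (lam k) *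
      ∫⁻ ξ, ‖(nemG g x (e k) - nemG g y (e k)) ξ‖ₑ ^ 2 ∂(μO O)) 0
  have h2 : ∫⁻ ξ, ‖(nemG g x (e 0) - nemG g y (e 0)) ξ‖ₑ ^ 2 ∂(μO O) = ‖g a - g b‖ₑ ^ 2 := by
    have e1 : ∫⁻ ξ, ‖(nemG g x (e 0) - nemG g y (e 0)) ξ‖ₑ ^ 2 ∂(μO O) =
        ∫⁻ ξ, ‖g a - g b‖ₑ ^ 2 * ‖(e 0 : L2 O) ξ‖ₑ ^ 2 ∂(μO O) := by
      refine lintegral_congr_ae ?_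
      filter_upwards [(memLp_const a : MemLp (fun _ => a) 2 (μO O)).coeFn_toLp,
        (memLp_const b : MemLp (fun _ => b) 2 (μO O)).coeFn_toLp] with ξ h3 h4
      simp only [nemG, Pi.sub_apply, hx, hy, h3, h4]
      rw [← sub_mul, enorm_mul, mul_pow]
    rw [e1, lintegral_const_mul' _ _ (by simp), ← enorm_toLp_sq (Lp.memLp (e 0)),
      Lp.toLp_coeFn, ← ofReal_norm (e 0), e.orthonormal.1 0]
    simp
  rw [h2, ← ofReal_norm, ← ENNReal.ofReal_pow (norm_nonneg _), ← ENNReal.ofReal_mul (hlam 0).le,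
    ENNReal.ofReal_le_ofReal_iff (mul_nonneg hg.nonneg₆ (sq_nonneg _))] at h1
  have h3 : |g a - g b| ^ 2 ≤ (√(L₆ / lam 0) * (C * |a - b|)) ^ 2 := by
    rw [mul_pow, Real.sq_sqrt (div_nonneg hg.nonneg₆ (hlam 0).le), div_mul_eq_mul_div,
      le_div_iff₀ (hlam 0), mul_comm]
    refine h1.trans ?_
    have := hg.nonneg₆
    gcongr
  rw [mul_assoc]
  exact (pow_le_pow_iff_left₀ (abs_nonneg _) (by positivity) two_ne_zero).1 h3

variable {f g : ℝ → ℝ} {q L₁ L₂ L₃ L₄ L₅ L₆ L₇ L₈ : ℝ}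

lemma memLp_drift (hOb : Bornology.IsBounded (O : Set (E d)))
    (hf : DriftAssumption d f q L₁ L₂ L₃ L₄ L₅) (x : Vh 𝒯) :
    MemLp (fun ξ => f ((x : L2 O) ξ)) 2 (μO O) := by
  have : IsFiniteMeasure (μO O) := ⟨by simpa using hOb.measure_lt_top⟩
  obtain ⟨C, hC⟩ := exists_ae_abs_le hOb 𝒯 x
  obtain ⟨K, hK0, hK⟩ := hf.exists_lipschitzOn C
  refine MemLp.of_bound (hf.differentiable.continuous.comp_aestronglyMeasurable
    (Lp.aestronglyMeasurable _)) (|f 0| + K * C) ?_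
  filter_upwards [hC] with ξ h1
  have hC0 : 0 ≤ C := (abs_nonneg _).trans h1
  have h2 := hK ((x : L2 O) ξ) 0 h1 (by simpa using hC0)
  have h3 : |f ((x : L2 O) ξ)| ≤ |f 0| + |f ((x : L2 O) ξ) - f 0| := by
    simpa using abs_add_le (f 0) (f ((x : L2 O) ξ) - f 0)
  rw [sub_zero] at h2
  rw [Real.norm_eq_abs]
  have h4 : K * |(x : L2 O) ξ| ≤ K * C := by gcongr
  linarith

/-- Pairing with an element of `V_h` removes the projection, and the one-sided Lipschitz bound is
integrated pointwise. -/
lemma inner_drift_sub_le (hOb : Bornology.IsBounded (O : Set (E d)))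
    (hf : DriftAssumption d f q L₁ L₂ L₃ L₄ L₅) (x y : Vh 𝒯) :
    inner ℝ (x - y) (Ph 𝒯 (toHm1 O fun ξ => f ((x : L2 O) ξ)) -
        Ph 𝒯 (toHm1 O fun ξ => f ((y : L2 O) ξ))) ≤ L₁ * ‖x - y‖ ^ 2 := by
  have hx := memLp_drift 𝒯 hOb hf x
  have hy := memLp_drift 𝒯 hOb hf y
  have h0 : ‖x - y‖ ^ 2 = ∫ ξ, ((x - y : Vh 𝒯) : L2 O) ξ ^ 2 ∂(μO O) :=
    norm_sq_eq_integral ((x - y : Vh 𝒯) : L2 O)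
  rw [inner_sub_right, inner_Ph_toHm1 𝒯 hx, inner_Ph_toHm1 𝒯 hy,
    ← integral_sub (integrable_mul_Lp hx _) (integrable_mul_Lp hy _), h0, ← integral_const_mul]
  refine integral_mono_ae ((integrable_mul_Lp hx _).sub (integrable_mul_Lp hy _))
    ((Lp.memLp ((x - y : Vh 𝒯) : L2 O)).integrable_sq.const_mul _) ?_
  filter_upwards [Lp.coeFn_sub (x : L2 O) (y : L2 O)] with ξ h1
  have h2 : ((x - y : Vh 𝒯) : L2 O) ξ = (x : L2 O) ξ - (y : L2 O) ξ := h1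
  rw [h2, ← sub_mul]
  exact hf.mono _ _

lemma norm_drift_sub_le (hOb : Bornology.IsBounded (O : Set (E d)))
    (hf : DriftAssumption d f q L₁ L₂ L₃ L₄ L₅) {K R : ℝ}
    (hK : ∀ ξ η, |ξ| ≤ R → |η| ≤ R → |f ξ - f η| ≤ K * |ξ - η|) (x y : Vh 𝒯)
    (hx : ∀ᵐ ξ ∂(μO O), |(x : L2 O) ξ| ≤ R) (hy : ∀ᵐ ξ ∂(μO O), |(y : L2 O) ξ| ≤ R) :
    ‖Ph 𝒯 (toHm1 O fun ξ => f ((x : L2 O) ξ)) -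
        Ph 𝒯 (toHm1 O fun ξ => f ((y : L2 O) ξ))‖ ≤ K * ‖x - y‖ := by
  have hxm := memLp_drift 𝒯 hOb hf x
  have hym := memLp_drift 𝒯 hOb hf y
  rw [Ph_toHm1_sub 𝒯 hxm hym]
  refine norm_Ph_toHm1_le_mul 𝒯 (hxm.sub hym) (u := ((x - y : Vh 𝒯) : L2 O)) ?_
  filter_upwards [Lp.coeFn_sub (x : L2 O) (y : L2 O), hx, hy] with ξ h1 h2 h3
  have h4 : ((x - y : Vh 𝒯) : L2 O) ξ = (x : L2 O) ξ - (y : L2 O) ξ := h1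
  rw [h4]
  exact hK _ _ h2 h3

/-- On `V_h` an `L²` ball is bounded in the uniform norm, so only the values of `f` on a bounded
interval matter. -/
lemma drift_lipschitzOn (hOb : Bornology.IsBounded (O : Set (E d)))
    (hf : DriftAssumption d f q L₁ L₂ L₃ L₄ L₅) (R : ℝ) :
    ∃ K : ℝ, ∀ x y : Vh 𝒯, ‖x‖ ≤ R → ‖y‖ ≤ R →
      ‖Ph 𝒯 (toHm1 O fun ξ => f ((x : L2 O) ξ)) -
        Ph 𝒯 (toHm1 O fun ξ => f ((y : L2 O) ξ))‖ ≤ K * ‖x - y‖ := by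
  obtain ⟨C, hC0, hC⟩ := exists_ae_abs_le_mul_norm hOb 𝒯
  have hK := hf.exists_lipschitzOn (C * R)
  have hb : ∀ x : Vh 𝒯, ‖x‖ ≤ R → ∀ᵐ ξ ∂(μO O), |(x : L2 O) ξ| ≤ C * R := fun x hx =>
    (hC x).mono fun ξ h1 => h1.trans (mul_le_mul_of_nonneg_left hx hC0)
  exact ⟨hK.choose, fun x y hx hy =>
    norm_drift_sub_le 𝒯 hOb hf hK.choose_spec.2 x y (hb x hx) (hb y hy)⟩

lemma exists_nemG_bound (hOb : Bornology.IsBounded (O : Set (E d))) {K : ℝ≥0}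
    (hg : LipschitzWith K g) (x : Vh 𝒯) :
    ∃ C : ℝ, ∀ u : L2 O, ∀ᵐ ξ ∂(μO O), |nemG g (x : L2 O) u ξ| ≤ C * |u ξ| := by
  obtain ⟨C, hC⟩ := exists_ae_abs_le hOb 𝒯 x
  refine ⟨|g 0| + K * C, fun u => ?_⟩
  filter_upwards [hC] with ξ h1
  rw [nemG, abs_mul]
  refine mul_le_mul_of_nonneg_right ?_ (abs_nonneg _)
  have h2 := hg.dist_le_mul ((x : L2 O) ξ) 0
  rw [Real.dist_eq, Real.dist_eq, sub_zero] at h2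
  have h3 : |g ((x : L2 O) ξ)| ≤ |g 0| + |g ((x : L2 O) ξ) - g 0| := by
    simpa using abs_add_le (g 0) (g ((x : L2 O) ξ) - g 0)
  have h4 : (K : ℝ) * |(x : L2 O) ξ| ≤ K * C := mul_le_mul_of_nonneg_left h1 K.coe_nonneg
  linarith

lemma memLp_nemG (hOb : Bornology.IsBounded (O : Set (E d))) {K : ℝ≥0} (hg : LipschitzWith K g)
    (x : Vh 𝒯) (u : L2 O) : MemLp (nemG g (x : L2 O) u) 2 (μO O) := by
  obtain ⟨C, hC⟩ := exists_nemG_bound 𝒯 hOb hg x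
  exact MemLp.of_le_mul (c := C) (Lp.memLp u)
    ((hg.continuous.comp_aestronglyMeasurable (Lp.aestronglyMeasurable _)).mul
      (Lp.aestronglyMeasurable _)) (hC u)

lemma norm_noise_sub_le {C : ℝ} (hC : ∀ u : Vh 𝒯, ∀ᵐ ξ ∂(μO O), |(u : L2 O) ξ| ≤ C * ‖u‖)
    (hOb : Bornology.IsBounded (O : Set (E d))) {K : ℝ≥0}
    (hg : LipschitzWith K g) (x y : Vh 𝒯) (u : L2 O) :
    ‖Ph 𝒯 (toHm1 O (nemG g (x : L2 O) u)) - Ph 𝒯 (toHm1 O (nemG g (y : L2 O) u))‖ ≤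
      K * C * ‖x - y‖ * ‖u‖ := by
  have hx := memLp_nemG 𝒯 hOb hg x u
  have hy := memLp_nemG 𝒯 hOb hg y u
  rw [Ph_toHm1_sub 𝒯 hx hy]
  refine norm_Ph_toHm1_le_mul 𝒯 (hx.sub hy) ?_
  filter_upwards [Lp.coeFn_sub (x : L2 O) (y : L2 O), hC (x - y)] with ξ h1 h2
  have h3 : ((x - y : Vh 𝒯) : L2 O) ξ = (x : L2 O) ξ - (y : L2 O) ξ := h1
  rw [h3] at h2
  have h4 := hg.dist_le_mul ((x : L2 O) ξ) ((y : L2 O) ξ)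
  rw [Real.dist_eq, Real.dist_eq] at h4
  simp only [nemG, Pi.sub_apply]
  rw [← sub_mul, abs_mul]
  refine mul_le_mul_of_nonneg_right ?_ (abs_nonneg _)
  rw [mul_assoc]
  exact h4.trans (mul_le_mul_of_nonneg_left h2 K.coe_nonneg)

/-- The discretised diffusion coefficient `x ↦ 𝒫_h G(x)` is a continuous map into the bounded
operators. -/
lemma exists_noise (hOb : Bornology.IsBounded (O : Set (E d))) {K : ℝ≥0}
    (hg : LipschitzWith K g) :
    ∃ N : Vh 𝒯 → L2 O →L[ℝ] Vh 𝒯,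
      (∀ x u, N x u = Ph 𝒯 (toHm1 O (nemG g (x : L2 O) u))) ∧ Continuous N := by
  have hm := memLp_nemG 𝒯 hOb hg
  obtain ⟨C, hC0, hC⟩ := exists_ae_abs_le_mul_norm hOb 𝒯
  refine exists_continuous_clm
    (T := fun (x : Vh 𝒯) (u : L2 O) => Ph 𝒯 (toHm1 O (nemG g (x : L2 O) u)))
    (fun x u v => ?_) (fun x a u => ?_) (fun x => ?_) (K := K * C)
    (mul_nonneg K.coe_nonneg hC0) (norm_noise_sub_le 𝒯 hC hOb hg)
  · refine (Ph_toHm1_congr 𝒯 (hm x _) ((hm x u).add (hm x v)) ?_).trans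
      (Ph_toHm1_add 𝒯 (hm x u) (hm x v))
    filter_upwards [Lp.coeFn_add u v] with ξ h1
    simp only [nemG, h1, Pi.add_apply]
    ring
  · refine (Ph_toHm1_congr 𝒯 (hm x _) ((hm x u).const_smul a) ?_).trans
      (Ph_toHm1_const_smul 𝒯 (hm x u) a)
    filter_upwards [Lp.coeFn_smul a u] with ξ h1
    simp only [nemG, h1, Pi.smul_apply, smul_eq_mul]
    ring
  · obtain ⟨c, hc⟩ := exists_nemG_bound 𝒯 hOb hg x
    exact ⟨c, fun u => norm_Ph_toHm1_le_mul 𝒯 (hm x u) (hc u)⟩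

/-- The Hilbert--Schmidt norm does not increase under the projection on `V_h`. -/
lemma tsum_enorm_Ph_sq_le {lam : ℕ → ℝ} {T : ℕ → E d → ℝ} (hT : ∀ k, MemLp (T k) 2 (μO O)) :
    ∑' k, ENNReal.ofReal (lam k) * ‖Ph 𝒯 (toHm1 O (T k))‖ₑ ^ 2 ≤ hsNormSq O lam T :=
  ENNReal.tsum_le_tsum fun k => mul_le_mul_right (enorm_Ph_toHm1_sq_le 𝒯 (hT k)) _

lemma tsum_noise_sub_le (hOb : Bornology.IsBounded (O : Set (E d)))
    {e : HilbertBasis ℕ ℝ (L2 O)} {lam : ℕ → ℝ} (hg : DiffusionAssumption e lam g L₆ L₇ L₈)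
    {K : ℝ≥0} (hK : LipschitzWith K g) {N : Vh 𝒯 → L2 O →L[ℝ] Vh 𝒯}
    (hN : ∀ x u, N x u = Ph 𝒯 (toHm1 O (nemG g (x : L2 O) u))) (x y : Vh 𝒯) :
    ∑' k, ENNReal.ofReal (lam k) * ‖N x (e k) - N y (e k)‖ₑ ^ 2 ≤
      ENNReal.ofReal (L₆ * ‖x - y‖ ^ 2) := by
  have hm := memLp_nemG 𝒯 hOb hK
  have h1 : ∀ k, N x (e k) - N y (e k) =
      Ph 𝒯 (toHm1 O (nemG g (x : L2 O) (e k) - nemG g (y : L2 O) (e k))) := fun k =>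
    (congrArg₂ (· - ·) (hN x (e k)) (hN y (e k))).trans (Ph_toHm1_sub 𝒯 (hm x _) (hm y _))
  have h2 := (tsum_enorm_Ph_sq_le 𝒯 (lam := lam) fun k => (hm x (e k)).sub (hm y (e k))).trans
    (hg.lip x y)
  exact (tsum_congr fun k => by rw [h1 k]).trans_le h2

lemma tsum_noise_zero_lt_top (hOb : Bornology.IsBounded (O : Set (E d)))
    {e : HilbertBasis ℕ ℝ (L2 O)} {lam : ℕ → ℝ} (hg : DiffusionAssumption e lam g L₆ L₇ L₈)
    {K : ℝ≥0} (hK : LipschitzWith K g) {N : Vh 𝒯 → L2 O →L[ℝ] Vh 𝒯}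
    (hN : ∀ x u, N x u = Ph 𝒯 (toHm1 O (nemG g (x : L2 O) u))) :
    ∑' k, ENNReal.ofReal (lam k) * ‖N 0 (e k)‖ₑ ^ 2 < ∞ := by
  have h2 := (tsum_enorm_Ph_sq_le 𝒯 (lam := lam) fun k => memLp_nemG 𝒯 hOb hK 0 (e k)).trans
    (hg.growth _)
  exact ((tsum_congr fun k => by rw [hN]).trans_le h2).trans_lt ENNReal.ofReal_lt_top

end FiniteElements

/-! ### The step map, its law and its contraction in mean. -/

section Chain

open BoundedContinuousFunction

/-- Jensen: on a probability space the `L¹` norm is at most the `L²` norm. -/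
lemma lintegral_enorm_le_of_sq {U V : Type*} [MeasurableSpace U] [NormedAddCommGroup V]
    {ν : Measure U} [IsProbabilityMeasure ν] {F : U → V} (hF : AEStronglyMeasurable F ν) {A : ℝ≥0∞}
    (hA : ∫⁻ u, ‖F u‖ₑ ^ 2 ∂ν ≤ A ^ 2) : ∫⁻ u, ‖F u‖ₑ ∂ν ≤ A := by
  have h1 : eLpNorm F 2 ν ^ 2 = ∫⁻ u, ‖F u‖ₑ ^ 2 ∂ν := by
    simpa using eLpNorm_nnreal_pow_eq_lintegral (f := F) (μ := ν) (p := 2) (by norm_num)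
  rw [← eLpNorm_one_eq_lintegral_enorm]
  refine (eLpNorm_le_eLpNorm_of_exponent_le one_le_two hF).trans ?_
  rw [← h1] at hA
  exact (ENNReal.pow_le_pow_left_iff two_ne_zero).1 hA

/-- The law of a random recursion driven by independent increments is given by the iterates of
its Markov operator. -/
lemma integral_chain {V U Ω : Type*} [NormedAddCommGroup V] [MeasurableSpace V] [BorelSpace V]
    [MeasurableSpace U] [MeasurableSpace Ω] {P : Measure Ω} [IsProbabilityMeasure P]
    {Ψ : V → U → V} {ν : Measure U} [IsProbabilityMeasure ν]
    {hΨ : Measurable (Function.uncurry Ψ)} {hc : ∀ u, Continuous fun x => Ψ x u}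
    {X : ℕ → Ω → V} {ξ : ℕ → Ω → U} {x : V} (hX : ∀ m, Measurable (X m))
    (hξ : ∀ m, Measurable (ξ m)) (hind : ∀ m, IndepFun (X m) (ξ m) P)
    (hlaw : ∀ m, P.map (ξ m) = ν) (h0 : ∀ᵐ ω ∂P, X 0 ω = x)
    (hstep : ∀ m, ∀ᵐ ω ∂P, X (m + 1) ω = Ψ (X m ω) (ξ m ω)) (m : ℕ) (φ : V →ᵇ ℝ) :
    ∫ ω, φ (X m ω) ∂P = (markovOp Ψ ν hΨ hc)^[m] φ x := by
  induction m generalizing φ with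
  | zero =>
    have : ∫ ω, φ (X 0 ω) ∂P = ∫ _, φ x ∂P :=
      integral_congr_ae (h0.mono fun ω hω => congrArg φ hω)
    rw [this]
    simp
  | succ m ih =>
    have hm : Measurable fun p : V × U => Ψ p.1 p.2 := hΨ
    have hφ : Measurable fun p : V × U => φ (Ψ p.1 p.2) := φ.continuous.measurable.comp hm
    have := Measure.isProbabilityMeasure_map (μ := P) (hX m).aemeasurable
    calc ∫ ω, φ (X (m + 1) ω) ∂P = ∫ ω, φ (Ψ (X m ω) (ξ m ω)) ∂P :=
          integral_congr_ae ((hstep m).mono fun ω hω => congrArg φ hω)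
      _ = ∫ p, φ (Ψ p.1 p.2) ∂(P.map fun ω => (X m ω, ξ m ω)) :=
          (integral_map ((hX m).prodMk (hξ m)).aemeasurable hφ.aestronglyMeasurable).symm
      _ = ∫ p, φ (Ψ p.1 p.2) ∂((P.map (X m)).prod ν) := by
          rw [(indepFun_iff_map_prod_eq_prod_map_map (hX m).aemeasurable
            (hξ m).aemeasurable).1 (hind m), hlaw]
      _ = ∫ a, markovOp Ψ ν hΨ hc φ a ∂(P.map (X m)) :=
          integral_prod _ (Integrable.of_bound hφ.aestronglyMeasurable ‖φ‖
            (ae_of_all _ fun _ => φ.norm_coe_le_norm _))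
      _ = ∫ ω, markovOp Ψ ν hΨ hc φ (X m ω) ∂P :=
          integral_map (hX m).aemeasurable
            (BoundedContinuousFunction.continuous _).measurable.aestronglyMeasurable
      _ = _ := by rw [ih, Function.iterate_succ_apply]

variable {H V : Type*} [NormedAddCommGroup H] [InnerProductSpace ℝ H]
  [NormedAddCommGroup V] [InnerProductSpace ℝ V]

/-- One step of an implicit scheme with resolvent `S` and noise operator `N`. -/
def stepMap (S : V → V) (N : V → H →L[ℝ] V) (x : V) (u : H) : V := S (x + N x u)

variable {S : V → V} {N : V → H →L[ℝ] V} {c : ℝ}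

lemma continuous_of_expansive_inverse {V : Type*} [NormedAddCommGroup V] {S : V → V} {c : ℝ}
    (hc : 0 < c) (hS : ∀ a b, c * ‖S a - S b‖ ≤ ‖a - b‖) :
    Continuous S := by
  refine LipschitzWith.continuous (K := ⟨c⁻¹, by positivity⟩)
    (LipschitzWith.of_dist_le_mul fun a b => ?_)
  rw [dist_eq_norm, dist_eq_norm]
  change _ ≤ c⁻¹ * _
  rw [← div_eq_inv_mul, le_div_iff₀ hc, mul_comm]
  exact hS a b

lemma continuous_uncurry_stepMap (hS : Continuous S) (hN : Continuous N) :
    Continuous (Function.uncurry (stepMap S N)) :=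
  hS.comp (continuous_fst.add ((hN.comp continuous_fst).clm_apply continuous_snd))

lemma measurable_uncurry_stepMap [MeasurableSpace H] [BorelSpace H] [SecondCountableTopology H]
    [MeasurableSpace V] [BorelSpace V] (hS : Continuous S) (hN : Continuous N) :
    Measurable (Function.uncurry (stepMap S N)) :=
  (continuous_uncurry_stepMap hS hN).measurable

lemma eq_stepMap_iff {A : V →ₗ[ℝ] V} {F : V → V} {τ : ℝ}
    (hS : ∀ y b, implicitMap A F τ y = b ↔ y = S b) (x y : V) (u : H) :
    y = x + τ • A y + τ • F y + N x u ↔ y = stepMap S N x u := by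
  rw [stepMap, ← hS, implicitMap, sub_sub, sub_eq_iff_eq_add]
  refine Eq.congr_right ?_
  abel

variable [CompleteSpace H] [MeasurableSpace H] [BorelSpace H] [FiniteDimensional ℝ V]
variable {ν : Measure H} [IsProbabilityMeasure ν] {Q : H →L[ℝ] H} {t : ℝ≥0}

/-- `S` has linear growth and the Gaussian noise `N 0 u` has a finite second moment. This supplies
the first-step constant in the moment bounds. -/
lemma lintegral_stepMap_zero_lt_top (hc : 0 < c) (hS : ∀ a b, c * ‖S a - S b‖ ≤ ‖a - b‖)
    (e : HilbertBasis ℕ ℝ H) {lam : ℕ → ℝ} (hlam : ∀ k, 0 ≤ lam k)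
    (hQ : ∀ k, Q (e k) = lam k • e k) (hν : ∀ u, ν.map (fun w => inner ℝ w u) =
      gaussianReal 0 (t * (inner ℝ (Q u) u).toNNReal))
    (hN0 : ∑' k, ENNReal.ofReal (lam k) * ‖N 0 (e k)‖ₑ ^ 2 < ∞) :
    ∫⁻ u, ‖stepMap S N 0 u‖ₑ ∂ν < ∞ := by
  have h1 : ∫⁻ u, ‖N 0 u‖ₑ ^ 2 ∂ν < ∞ := by
    have := lintegral_affine_sq e hlam hQ hν (0 : V) (N 0)
    simp only [zero_add] at this
    rw [this]
    exact ENNReal.add_lt_top.2 ⟨by simp, ENNReal.mul_lt_top ENNReal.coe_lt_top hN0⟩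
  have h2 : ∫⁻ u, ‖N 0 u‖ₑ ∂ν < ∞ := by
    refine lt_of_le_of_lt (lintegral_mono fun u => ?_ : _ ≤ ∫⁻ u, (1 + ‖N 0 u‖ₑ ^ 2) ∂ν) ?_
    · rcases le_total ‖N 0 u‖ₑ 1 with hu | hu
      · exact hu.trans le_self_add
      · exact (le_self_pow₀ hu two_ne_zero).trans le_add_self
    · rw [lintegral_add_left measurable_const]
      simpa using h1
  refine lt_of_le_of_lt (lintegral_mono fun u => ?_ :
    _ ≤ ∫⁻ u, (‖S 0‖ₑ + ENNReal.ofReal c⁻¹ * ‖N 0 u‖ₑ) ∂ν) ?_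
  · have h3 := hS (0 + N 0 u) 0
    rw [zero_add, sub_zero] at h3
    have h4 : ‖S (N 0 u)‖ ≤ ‖S 0‖ + c⁻¹ * ‖N 0 u‖ := by
      have h5 : ‖S (N 0 u) - S 0‖ ≤ c⁻¹ * ‖N 0 u‖ := by
        rw [← div_eq_inv_mul, le_div_iff₀ hc, mul_comm]
        exact h3
      have := norm_add_le (S 0) (S (N 0 u) - S 0)
      rw [add_sub_cancel] at this
      linarith
    simp only [stepMap, zero_add]
    rw [← ofReal_norm, ← ofReal_norm, ← ofReal_norm, ← ENNReal.ofReal_mul (by positivity),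
      ← ENNReal.ofReal_add (by positivity) (by positivity)]
    exact ENNReal.ofReal_le_ofReal h4
  · rw [lintegral_add_left measurable_const, lintegral_const_mul' _ _ ENNReal.ofReal_ne_top]
    exact ENNReal.add_lt_top.2 ⟨by simp, ENNReal.mul_lt_top ENNReal.ofReal_lt_top h2⟩

variable [SecondCountableTopology H] [MeasurableSpace V] [BorelSpace V]

/-- The isometry for the noise gives the factor `1 + t L` in mean square; the resolvent divides by
`c²`, and Jensen passes to the first moment. -/
lemma lintegral_stepMap_sub_le (hc : 0 < c) (hS : ∀ a b, c * ‖S a - S b‖ ≤ ‖a - b‖)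
    (hN : Continuous N) (e : HilbertBasis ℕ ℝ H) {lam : ℕ → ℝ} (hlam : ∀ k, 0 ≤ lam k)
    (hQ : ∀ k, Q (e k) = lam k • e k) (hν : ∀ u, ν.map (fun w => inner ℝ w u) =
      gaussianReal 0 (t * (inner ℝ (Q u) u).toNNReal)) {L : ℝ} (hL : 0 ≤ L)
    (hNL : ∀ x y, ∑' k, ENNReal.ofReal (lam k) * ‖N x (e k) - N y (e k)‖ₑ ^ 2 ≤
      ENNReal.ofReal (L * ‖x - y‖ ^ 2)) {r : ℝ≥0} (hr : 1 + t * L ≤ (c * r) ^ 2) (x y : V) :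
    ∫⁻ u, ‖stepMap S N x u - stepMap S N y u‖ₑ ∂ν ≤ r * ‖x - y‖ₑ := by
  have hSc := continuous_of_expansive_inverse hc hS
  have h1 : ∫⁻ u, ‖(x - y) + (N x - N y) u‖ₑ ^ 2 ∂ν ≤ (ENNReal.ofReal (c * r * ‖x - y‖)) ^ 2 := by
    rw [lintegral_affine_sq e hlam hQ hν]
    calc ‖x - y‖ₑ ^ 2 + t * ∑' k, ENNReal.ofReal (lam k) * ‖(N x - N y) (e k)‖ₑ ^ 2
        ≤ ‖x - y‖ₑ ^ 2 + t * ENNReal.ofReal (L * ‖x - y‖ ^ 2) := by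
          gcongr
          exact hNL x y
      _ = ENNReal.ofReal ((1 + t * L) * ‖x - y‖ ^ 2) := by
          rw [← ofReal_norm, ← ENNReal.ofReal_pow (norm_nonneg _), ← ENNReal.ofReal_coe_nnreal,
            ← ENNReal.ofReal_mul t.coe_nonneg,
            ← ENNReal.ofReal_add (by positivity) (by positivity)]
          congr 1
          ring
      _ ≤ ENNReal.ofReal ((c * r) ^ 2 * ‖x - y‖ ^ 2) := by gcongr
      _ = _ := by rw [← ENNReal.ofReal_pow (by positivity)]; congr 1; ring
  have h2 := lintegral_enorm_le_of_sq
    (by fun_prop : Continuous fun u => (x - y) + (N x - N y) u).aestronglyMeasurable h1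
  -- Multiplying by `c` matches the form of `hS`; the positive finite factor is cancelled at the
  -- end.
  have h3 : ENNReal.ofReal c * ∫⁻ u, ‖stepMap S N x u - stepMap S N y u‖ₑ ∂ν ≤
      ENNReal.ofReal c * (r * ‖x - y‖ₑ) := by
    rw [← lintegral_const_mul _
      (measurable_step_sub (measurable_uncurry_stepMap hSc hN) x y).enorm]
    calc ∫⁻ u, ENNReal.ofReal c * ‖stepMap S N x u - stepMap S N y u‖ₑ ∂ν
        ≤ ∫⁻ u, ‖(x - y) + (N x - N y) u‖ₑ ∂ν := by
          refine lintegral_mono fun u => ?_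
          rw [← ofReal_norm, ← ofReal_norm, ← ENNReal.ofReal_mul hc.le]
          refine ENNReal.ofReal_le_ofReal ((hS _ _).trans (le_of_eq ?_))
          congr 1
          rw [_root_.sub_apply]
          abel
      _ ≤ ENNReal.ofReal (c * r * ‖x - y‖) := h2
      _ = _ := by
          rw [mul_assoc, ENNReal.ofReal_mul hc.le, ENNReal.ofReal_mul r.coe_nonneg, ofReal_norm,
            ENNReal.ofReal_coe_nnreal]
  exact (ENNReal.mul_le_mul_iff_right (ENNReal.ofReal_pos.2 hc).ne' ENNReal.ofReal_ne_top).1 h3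

end Chain

/-! ### Wiener increments and solutions as a recursion. -/

section Solution

instance instSecondCountableTopologyL2 (O : TopologicalSpace.Opens (E d)) :
    SecondCountableTopology (L2 O) :=
  haveI : Fact ((2 : ℝ≥0∞) ≠ ∞) := ⟨ENNReal.ofNat_ne_top⟩
  Lp.SecondCountableTopology

variable {Ω : Type*} [MeasurableSpace Ω] {P : Measure Ω}
  {𝓕 : Filtration ℝ≥0 ‹MeasurableSpace Ω›} {W : ℝ≥0 → Ω → L2 O} {Q : L2 O →L[ℝ] L2 O} {τ : ℝ≥0}

/-- The increment `W(t_{m+1}) - W(t_m)` of the noise. -/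
def increment (W : ℝ≥0 → Ω → L2 O) (τ : ℝ≥0) (m : ℕ) (ω : Ω) : L2 O :=
  W ((m + 1) * τ) ω - W (m * τ) ω

lemma mul_le_succ_mul (τ : ℝ≥0) (m : ℕ) : (m : ℝ≥0) * τ ≤ (m + 1) * τ := by
  gcongr
  exact le_self_add

lemma IsQWiener.measurable_increment (hW : IsQWiener Q P 𝓕 W) (m : ℕ) :
    Measurable[𝓕 ((m + 1) * τ)] (increment W τ m) :=
  (hW.adapted _).sub ((hW.adapted _).mono (𝓕.mono (mul_le_succ_mul τ m)) le_rfl)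

lemma IsQWiener.map_inner_increment (hW : IsQWiener Q P 𝓕 W) (m : ℕ) (u : L2 O) :
    (P.map (increment W τ m)).map (fun w => inner ℝ w u) =
      gaussianReal 0 (τ * (inner ℝ (Q u) u).toNNReal) := by
  have h1 : Measurable (increment W τ m) := (hW.measurable_increment m).mono (𝓕.le _) le_rfl
  have h2 : ((m : ℝ≥0) + 1) * τ - m * τ = τ := by
    rw [add_mul, one_mul, add_tsub_cancel_left]
  rw [Measure.map_map (by fun_prop) h1]
  have h3 := hW.gaussian (m * τ) ((m + 1) * τ) (mul_le_succ_mul τ m) u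
  rw [h2] at h3
  exact h3

/-- The scalar marginals depend only on the step length `τ`, and they determine the law; hence one
Markov operator serves every step. -/
lemma IsQWiener.map_increment [IsProbabilityMeasure P] (hW : IsQWiener Q P 𝓕 W) (m : ℕ) :
    P.map (increment W τ m) = P.map (increment W τ 0) := by
  refine eq_of_gaussian_marginals fun u => ?_
  rw [hW.map_inner_increment, hW.map_inner_increment]

lemma IsQWiener.indepFun_increment (hW : IsQWiener Q P 𝓕 W) {V : Type*} [MeasurableSpace V]
    (m : ℕ) {Y : Ω → V} (hY : Measurable[𝓕 (m * τ)] Y) : IndepFun Y (increment W τ m) P := by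
  rw [IndepFun_iff_Indep]
  exact indep_of_indep_of_le_left (hW.indep _ _ (mul_le_succ_mul τ m)).symm hY.comap_le

variable {𝒯 : Partition O h} {f g : ℝ → ℝ} {S : Vh 𝒯 → Vh 𝒯} {N : Vh 𝒯 → L2 O →L[ℝ] Vh 𝒯}

/-- The implicit scheme is the explicit recursion given by the resolvent. -/
lemma isSolution_iff
    (hS : ∀ y b, implicitMap (Ah 𝒯) (fun y => Ph 𝒯 (toHm1 O fun ξ => f ((y : L2 O) ξ))) τ y = b ↔
      y = S b)
    (hN : ∀ x u, N x u = Ph 𝒯 (toHm1 O (nemG g (x : L2 O) u))) {x : L2 O} {X : ℕ → Ω → Vh 𝒯} :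
    IsSolution 𝒯 f g P 𝓕 W τ x X ↔ (∀ m : ℕ, Measurable[𝓕 (m * τ)] (X m)) ∧
      (∀ᵐ ω ∂P, X 0 ω = Ph 𝒯 (toHm1 O x)) ∧
      ∀ᵐ ω ∂P, ∀ m, X (m + 1) ω = stepMap S N (X m ω) (increment W τ m ω) := by
  have key : ∀ m ω, (X (m + 1) ω = X m ω + (τ : ℝ) • Ah 𝒯 (X (m + 1) ω)
      + (τ : ℝ) • Ph 𝒯 (toHm1 O fun ξ => f ((X (m + 1) ω : L2 O) ξ))
      + Ph 𝒯 (toHm1 O (nemG g (X m ω : L2 O) (W ((m + 1) * τ) ω - W (m * τ) ω : L2 O)))) ↔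
      X (m + 1) ω = stepMap S N (X m ω) (increment W τ m ω) := by
    intro m ω
    have h1 := hN (X m ω) (increment W τ m ω)
    have h2 := eq_stepMap_iff (N := N) hS (X m ω) (X (m + 1) ω) (increment W τ m ω)
    rw [h1] at h2
    exact h2
  constructor
  · rintro ⟨h1, h2, h3⟩
    exact ⟨h1, h2, h3.mono fun ω hω m => (key m ω).1 (hω m)⟩
  · rintro ⟨h1, h2, h3⟩
    exact ⟨h1, h2, h3.mono fun ω hω m => (key m ω).2 (hω m)⟩

/-- The process given by the recursion. -/
def chain (S : Vh 𝒯 → Vh 𝒯) (N : Vh 𝒯 → L2 O →L[ℝ] Vh 𝒯) (W : ℝ≥0 → Ω → L2 O) (τ : ℝ≥0)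
    (x : Vh 𝒯) : ℕ → Ω → Vh 𝒯
  | 0, _ => x
  | m + 1, ω => stepMap S N (chain S N W τ x m ω) (increment W τ m ω)

instance instProperSpaceVh (𝒯 : Partition O h) : ProperSpace (Vh 𝒯) := FiniteDimensional.proper ℝ _

lemma measurable_chain (hW : IsQWiener Q P 𝓕 W) (hS : Continuous S) (hN : Continuous N)
    (x : Vh 𝒯) (m : ℕ) : Measurable[𝓕 (m * τ)] (chain S N W τ x m) := by
  induction m with
  | zero => exact measurable_const
  | succ m ih =>
    have h1 := (measurable_uncurry_stepMap hS hN).comp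
      (Measurable.prodMk (ih.mono (𝓕.mono (mul_le_succ_mul τ m)) le_rfl)
        (hW.measurable_increment (τ := τ) m))
    rw [Nat.cast_add, Nat.cast_one]
    exact h1

end Solution

/-! ### The Lipschitz seminorm and the contraction rate. -/

lemma abs_sub_le_lipNorm {φ : L2 O → ℝ} (hφ : IsLipB φ) (x y : L2 O) :
    |φ x - φ y| ≤ lipNorm φ * ‖x - y‖ := by
  rcases eq_or_ne x y with rfl | hxy
  · simp
  have h0 : 0 < ‖x - y‖ := norm_pos_iff.2 (sub_ne_zero.2 hxy)
  rw [← div_le_iff₀ h0]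
  obtain ⟨-, K, hK⟩ := hφ
  refine le_csSup ⟨K, ?_⟩ ⟨x, y, hxy, rfl⟩
  rintro _ ⟨a, b, hab, rfl⟩
  rw [div_le_iff₀ (norm_pos_iff.2 (sub_ne_zero.2 hab)), ← Real.dist_eq, ← dist_eq_norm]
  exact hK.dist_le_mul a b

lemma lipNorm_nonneg (φ : L2 O → ℝ) : 0 ≤ lipNorm φ := by
  refine Real.sSup_nonneg ?_
  rintro _ ⟨x, y, -, rfl⟩
  positivity

/-- The contraction factor of one step is at most `e^{-γ τ / 2}`. -/
lemma contraction_rate_le {a L τ : ℝ} (ha : 0 < a) (hL : L < 2 * a) (hτ₀ : 0 < τ)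
    (hτ₁ : τ < 1) :
    1 + τ * L ≤ ((1 + τ * a) * Real.exp (-((2 * a - L) / (2 * a + 1)) * τ / 2)) ^ 2 := by
  set γ := (2 * a - L) / (2 * a + 1) with hγ
  have hγ0 : 0 < γ := div_pos (by linarith) (by linarith)
  have hγe : γ * (2 * a + 1) = 2 * a - L := by
    rw [hγ]
    field_simp
  have h1 : Real.exp (-γ * τ / 2) ^ 2 = Real.exp (-γ * τ) := by
    rw [← Real.exp_nat_mul]
    congr 1
    push_cast
    ring
  have h2 : 1 - γ * τ ≤ Real.exp (-γ * τ) := by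
    have := Real.add_one_le_exp (-γ * τ)
    linarith
  rw [mul_pow, h1]
  calc 1 + τ * L = (1 + 2 * τ * a) - γ * τ * (2 * a + 1) := by
        linear_combination τ * hγe
    _ ≤ (1 + 2 * τ * a) - γ * τ * (1 + 2 * τ * a) := by
        -- Here `τ < 1` enters: the denominator `2 a + 1` of `γ` is `1 + 2 τ a` at `τ = 1`, which
        -- gives a rate uniform in `τ`.
        have h3 : 1 + 2 * τ * a ≤ 2 * a + 1 := by nlinarith
        have := mul_le_mul_of_nonneg_left h3 (mul_pos hγ0 hτ₀).le
        linarith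
    _ = (1 + 2 * τ * a) * (1 - γ * τ) := by ring
    _ ≤ (1 + 2 * τ * a) * Real.exp (-γ * τ) := by gcongr
    _ ≤ (1 + τ * a) ^ 2 * Real.exp (-γ * τ) := by
        gcongr
        nlinarith [sq_nonneg (τ * a)]

/-! ### Transfer of the abstract results to the scheme. -/

section Ergodicity

open BoundedContinuousFunction

variable {Ω : Type*} [MeasurableSpace Ω] {P : Measure Ω}
  {𝓕 : Filtration ℝ≥0 ‹MeasurableSpace Ω›} {W : ℝ≥0 → Ω → L2 O} {Q : L2 O →L[ℝ] L2 O} {τ : ℝ≥0}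
  {𝒯 : Partition O h} {f g : ℝ → ℝ} {S : Vh 𝒯 → Vh 𝒯} {N : Vh 𝒯 → L2 O →L[ℝ] Vh 𝒯}

lemma Ph_toHm1_coe_self (y : Vh 𝒯) : Ph 𝒯 (toHm1 O (y : L2 O)) = y := by
  rw [Ph_toHm1_coe]
  exact Submodule.orthogonalProjectionOnto_mem_subspace_eq_self y

/-- The projection fixes `y` and is nonexpansive, so mixing from `𝒫_h x` yields the stated bound in
terms of `x` itself. -/
lemma norm_Ph_toHm1_sub_le (x : L2 O) (y : Vh 𝒯) :
    ‖Ph 𝒯 (toHm1 O x) - y‖ ≤ ‖x - (y : L2 O)‖ := by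
  have h1 : Ph 𝒯 (toHm1 O x) - y = (Vh 𝒯).orthogonalProjectionOnto (x - (y : L2 O)) := by
    rw [Ph_toHm1_coe, map_sub, Submodule.orthogonalProjectionOnto_mem_subspace_eq_self]
  rw [h1]
  exact Submodule.norm_orthogonalProjectionOnto_apply_le _ _

/-- Existence and uniqueness of solutions of the scheme. -/
lemma exists_unique_solution (hW : IsQWiener Q P 𝓕 W)
    (hS : ∀ y b, implicitMap (Ah 𝒯) (fun y => Ph 𝒯 (toHm1 O fun ξ => f ((y : L2 O) ξ))) τ y = b ↔
      y = S b)
    (hN : ∀ x u, N x u = Ph 𝒯 (toHm1 O (nemG g (x : L2 O) u)))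
    (hSc : Continuous S) (hNc : Continuous N) (x : L2 O) :
    (∃ X, IsSolution 𝒯 f g P 𝓕 W τ x X) ∧
      ∀ X Y, IsSolution 𝒯 f g P 𝓕 W τ x X → IsSolution 𝒯 f g P 𝓕 W τ x Y →
        ∀ᵐ ω ∂P, ∀ m, X m ω = Y m ω := by
  refine ⟨⟨chain S N W τ (Ph 𝒯 (toHm1 O x)), (isSolution_iff hS hN).2
    ⟨measurable_chain hW hSc hNc _, ae_of_all _ fun _ => rfl, ae_of_all _ fun _ _ => rfl⟩⟩, ?_⟩
  intro X Y hX hY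
  obtain ⟨-, hX0, hX1⟩ := (isSolution_iff hS hN).1 hX
  obtain ⟨-, hY0, hY1⟩ := (isSolution_iff hS hN).1 hY
  filter_upwards [hX0, hX1, hY0, hY1] with ω h1 h2 h3 h4 m
  induction m with
  | zero => rw [h1, h3]
  | succ m ih => rw [h2, h4, ih]

variable [IsProbabilityMeasure P]

/-- The Markov semigroup of the scheme is given by the powers of one operator. -/
lemma semigroup_eq {ν : Measure (L2 O)} [IsProbabilityMeasure ν] (hW : IsQWiener Q P 𝓕 W)
    (hS : ∀ y b, implicitMap (Ah 𝒯) (fun y => Ph 𝒯 (toHm1 O fun ξ => f ((y : L2 O) ξ))) τ y = b ↔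
      y = S b)
    (hN : ∀ x u, N x u = Ph 𝒯 (toHm1 O (nemG g (x : L2 O) u)))
    {hΨ : Measurable (Function.uncurry (stepMap S N))}
    {hc : ∀ u, Continuous fun x => stepMap S N x u}
    (hν : P.map (increment W τ 0) = ν)
    {X : L2 O → ℕ → Ω → Vh 𝒯} (hX : ∀ x, IsSolution 𝒯 f g P 𝓕 W τ x (X x))
    (m : ℕ) (φ : Vh 𝒯 →ᵇ ℝ) (x : L2 O) :
    semigroup P X m φ x =
      (markovOp (stepMap S N) ν hΨ hc)^[m] φ (Ph 𝒯 (toHm1 O x)) := by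
  obtain ⟨h0, h1, h2⟩ := (isSolution_iff hS hN).1 (hX x)
  exact integral_chain (ξ := increment W τ) (fun m => (h0 m).mono (𝓕.le _) le_rfl)
    (fun m => (hW.measurable_increment m).mono (𝓕.le _) le_rfl)
    (fun m => hW.indepFun_increment m (h0 m)) (fun m => (hW.map_increment m).trans hν) h1
    (fun m => h2.mono fun ω hω => hω m) m φ

/-- The restriction to `V_h` of a bounded Lipschitz continuous function on `H`. -/
def restrictVh (𝒯 : Partition O h) {φ : L2 O → ℝ} (hφ : IsLipB φ) : Vh 𝒯 →ᵇ ℝ :=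
  BoundedContinuousFunction.ofNormedAddCommGroup (fun y : Vh 𝒯 => φ y)
    (hφ.2.choose_spec.continuous.comp continuous_subtype_val) hφ.1.choose
    (fun y => hφ.1.choose_spec y)

lemma lipschitz_restrictVh {φ : L2 O → ℝ} (hφ : IsLipB φ) :
    LipschitzWith ⟨lipNorm φ, lipNorm_nonneg φ⟩ (restrictVh 𝒯 hφ) :=
  LipschitzWith.of_dist_le_mul fun x y => by
    rw [Subtype.dist_eq, Real.dist_eq, dist_eq_norm]
    exact abs_sub_le_lipNorm hφ x y

lemma integrable_norm_sub_coe (x : L2 O) {π : Measure (Vh 𝒯)} [IsProbabilityMeasure π]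
    (hπ : Integrable (fun y => ‖y‖) π) : Integrable (fun y : Vh 𝒯 => ‖x - (y : L2 O)‖) π := by
  refine ((integrable_const ‖x‖).add hπ).mono'
    (continuous_const.sub continuous_subtype_val).norm.measurable.aestronglyMeasurable
    (ae_of_all _ fun y => ?_)
  rw [norm_norm]
  exact norm_sub_le x (y : L2 O)

/-- Starting points in `V_h` are fixed by `𝒫_h`, so on `V_h` the semigroup is exactly the iterated
Markov operator and the abstract theory applies. -/
lemma exists_mixing_invariant_of_semigroup {ν : Measure (L2 O)} [IsProbabilityMeasure ν]
    {Ψ : Vh 𝒯 → L2 O → Vh 𝒯} {hΨ : Measurable (Function.uncurry Ψ)}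
    {hΨc : ∀ u, Continuous fun x => Ψ x u} {r : ℝ≥0} (hr1 : r < 1) {ρ : ℕ → ℝ}
    (hρ : ∀ m, (r : ℝ) ^ m = ρ m) (hr : ∀ x y, ∫⁻ u, ‖Ψ x u - Ψ y u‖ₑ ∂ν ≤ r * ‖x - y‖ₑ)
    (h0 : ∫⁻ u, ‖Ψ 0 u‖ₑ ∂ν < ∞)
    {X : L2 O → ℕ → Ω → Vh 𝒯} (hXm : ∀ x m, Measurable (X x m))
    (hsg : ∀ (m : ℕ) (φ : Vh 𝒯 →ᵇ ℝ) (x : L2 O),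
      semigroup P X m φ x = (markovOp Ψ ν hΨ hΨc)^[m] φ (Ph 𝒯 (toHm1 O x))) :
    ∃ π : ProbabilityMeasure (Vh 𝒯), IsInvariant P X π ∧ (∀ π', IsInvariant P X π' → π' = π) ∧
      ∀ x : L2 O, Integrable (fun y : Vh 𝒯 => ‖x - (y : L2 O)‖) (π : Measure (Vh 𝒯)) ∧
        ∀ (m : ℕ) (φ : L2 O → ℝ), IsLipB φ →
          |semigroup P X m (fun y => φ y) x - ∫ y : Vh 𝒯, φ y ∂(π : Measure (Vh 𝒯))| ≤
            ρ m * lipNorm φ * ∫ y : Vh 𝒯, ‖x - (y : L2 O)‖ ∂(π : Measure (Vh 𝒯)) := by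
  have hsg' : ∀ (m : ℕ) (φ : Vh 𝒯 →ᵇ ℝ) (y : Vh 𝒯),
      semigroup P X m φ (y : L2 O) = (markovOp Ψ ν hΨ hΨc)^[m] φ y := fun m φ y => by
    rw [hsg, Ph_toHm1_coe_self]
  -- The laws required by the abstract theorem are those of the given solution started at zero, and
  -- `C` is the mean norm after one step.
  have hex := exists_invariant_integrable_norm (hΨ := hΨ) (hc := hΨc) hr1 hr
    (C := (∫⁻ u, ‖Ψ 0 u‖ₑ ∂ν).toNNReal) (ENNReal.coe_toNNReal h0.ne).ge
    (fun m => ⟨P.map (X (0 : Vh 𝒯) m), Measure.isProbabilityMeasure_map (hXm _ m).aemeasurable⟩)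
    (fun m φ => (integral_map (hXm _ m).aemeasurable
      φ.continuous.measurable.aestronglyMeasurable).trans (hsg' m φ 0))
  have hπ := hex.choose_spec.1
  have hπi := hex.choose_spec.2
  refine ⟨hex.choose, fun φ m => ?_, fun π' hπ' => ?_, fun x => ?_⟩
  · exact (integral_congr_ae (ae_of_all _ fun y => hsg' m φ y)).trans
      (integral_iterate_markovOp hπ m φ)
  -- Invariance of `π'` is needed only for the single step `m = 1`.
  · exact eq_of_invariant (hΨ := hΨ) (hc := hΨc) hr1 hr hπ (fun φ =>
      (integral_congr_ae (ae_of_all _ fun y => (hsg' 1 φ y).symm)).trans (hπ' φ 1)) hπi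
  · have hnorm := integrable_norm_sub_coe x hπi
    refine ⟨hnorm, fun m φ hφ => ?_⟩
    have h1 := abs_iterate_sub_integral_le (hΨ := hΨ) (hc := hΨc) hr hπ hπi
      (lipschitz_restrictVh (𝒯 := 𝒯) hφ) m (Ph 𝒯 (toHm1 O x))
    have h3 := integral_mono_of_nonneg (ae_of_all _ fun _ => norm_nonneg _) hnorm
      (ae_of_all _ fun y => norm_Ph_toHm1_sub_le x y)
    have h4 : ∀ a b : ℝ, a ≤ b → lipNorm φ * (r : ℝ) ^ m * a ≤ ρ m * lipNorm φ * b := by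
      intro a b hab
      have h5 : 0 ≤ lipNorm φ * (r : ℝ) ^ m :=
        mul_nonneg (lipNorm_nonneg φ) (pow_nonneg r.coe_nonneg m)
      rw [← hρ m, mul_comm ((r : ℝ) ^ m)]
      exact mul_le_mul_of_nonneg_left hab h5
    exact (le_of_eq (congrArg (fun z => |z - _|) (hsg m (restrictVh 𝒯 hφ) x))).trans
      (h1.trans (h4 _ _ h3))

/-- The scheme has a unique invariant measure, and it is exponentially mixing. -/
theorem exists_mixing_invariant (hOb : Bornology.IsBounded (O : Set (E d)))
    {e : HilbertBasis ℕ ℝ (L2 O)} {lam : ℕ → ℝ} (hQ : IsCovariance Q e lam) {L₆ L₇ L₈ : ℝ}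
    (hg : DiffusionAssumption e lam g L₆ L₇ L₈) {K : ℝ≥0} (hK : LipschitzWith K g)
    (hW : IsQWiener Q P 𝓕 W)
    (hS : ∀ y b, implicitMap (Ah 𝒯) (fun y => Ph 𝒯 (toHm1 O fun ξ => f ((y : L2 O) ξ))) τ y = b ↔
      y = S b)
    (hN : ∀ x u, N x u = Ph 𝒯 (toHm1 O (nemG g (x : L2 O) u)))
    (hNc : Continuous N) {c γ : ℝ} (hc : 0 < c) (hSl : ∀ a b, c * ‖S a - S b‖ ≤ ‖a - b‖)
    (hγ : 0 < γ) (hτ₀ : 0 < τ)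
    (hrate : 1 + τ * L₆ ≤ (c * (⟨Real.exp (-γ * τ / 2), (Real.exp_pos _).le⟩ : ℝ≥0)) ^ 2)
    {X : L2 O → ℕ → Ω → Vh 𝒯} (hX : ∀ x, IsSolution 𝒯 f g P 𝓕 W τ x (X x)) :
    ∃ π : ProbabilityMeasure (Vh 𝒯), IsInvariant P X π ∧ (∀ π', IsInvariant P X π' → π' = π) ∧
      ∀ x : L2 O, Integrable (fun y : Vh 𝒯 => ‖x - (y : L2 O)‖) (π : Measure (Vh 𝒯)) ∧
        ∀ (m : ℕ) (φ : L2 O → ℝ), IsLipB φ →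
          |semigroup P X m (fun y => φ y) x - ∫ y : Vh 𝒯, φ y ∂(π : Measure (Vh 𝒯))| ≤
            Real.exp (-γ * (m * τ) / 2) * lipNorm φ *
              ∫ y : Vh 𝒯, ‖x - (y : L2 O)‖ ∂(π : Measure (Vh 𝒯)) := by
  have hτ₀' : (0 : ℝ) < τ := hτ₀
  have hlam : ∀ k, 0 ≤ lam k := fun k => (hQ.pos k).le
  have hSc := continuous_of_expansive_inverse hc hSl
  have : IsProbabilityMeasure (P.map (increment W τ 0)) := Measure.isProbabilityMeasure_map
    ((hW.measurable_increment 0).mono (𝓕.le _) le_rfl).aemeasurable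
  have hν := hW.map_inner_increment (τ := τ) 0
  have hΨ := measurable_uncurry_stepMap hSc hNc
  have hΨc : ∀ u, Continuous fun x => stepMap S N x u := fun u =>
    (continuous_uncurry_stepMap hSc hNc).comp (continuous_id.prodMk continuous_const)
  have hr1 : (⟨Real.exp (-γ * τ / 2), (Real.exp_pos _).le⟩ : ℝ≥0) < 1 := by
    refine NNReal.coe_lt_coe.1 (Real.exp_lt_one_iff.2 ?_)
    have := mul_pos hγ hτ₀'
    linarith
  have hr := lintegral_stepMap_sub_le hc hSl hNc e hlam hQ.eigen hν hg.nonneg₆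
    (tsum_noise_sub_le 𝒯 hOb hg hK hN) hrate
  have h0 := lintegral_stepMap_zero_lt_top hc hSl e hlam hQ.eigen hν
    (tsum_noise_zero_lt_top 𝒯 hOb hg hK hN)
  refine exists_mixing_invariant_of_semigroup (hΨ := hΨ) (hΨc := hΨc) hr1 (fun m => ?_) hr h0
    (fun x m => ((hX x).adapted m).mono (𝓕.le _) le_rfl)
    (semigroup_eq hW hS hN (hΨ := hΨ) (hc := hΨc) rfl hX)
  change Real.exp _ ^ m = _
  rw [← Real.exp_nat_mul]
  congr 1
  ring

end Ergodicity

end DIEG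
end

/-! ### Assembly of the main theorem. -/

theorem theorem3p2 {d : ℕ} (hd₁ : 1 ≤ d) (hd₃ : d ≤ 3)
    (O : TopologicalSpace.Opens (DIEG.E d)) (hOne : (O : Set (DIEG.E d)).Nonempty)
    (hOb : Bornology.IsBounded (O : Set (DIEG.E d)))
    (f g : ℝ → ℝ) (q L₁ L₂ L₃ L₄ L₅ L₆ L₇ L₈ : ℝ)
    (hf : DIEG.DriftAssumption d f q L₁ L₂ L₃ L₄ L₅)
    (Q : DIEG.L2 O →L[ℝ] DIEG.L2 O) (e : HilbertBasis ℕ ℝ (DIEG.L2 O)) (lam : ℕ → ℝ)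
    (hQ : DIEG.IsCovariance Q e lam)
    (hg : DIEG.DiffusionAssumption e lam g L₆ L₇ L₈)
    (hL : max (L₁ + L₆ / 2) (L₂ + L₇ / 2) < DIEG.firstEigenvalue O)
    {Ω : Type*} [MeasurableSpace Ω] (P : Measure Ω) [IsProbabilityMeasure P]
    (𝓕 : Filtration ℝ≥0 ‹MeasurableSpace Ω›) (W : ℝ≥0 → Ω → DIEG.L2 O)
    (hW : DIEG.IsQWiener Q P 𝓕 W)
    (τ : ℝ≥0) (hτ₀ : 0 < τ) (hτ₁ : τ < 1) (h : ℝ) (hh₀ : 0 < h) (hh₁ : h < 1)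
    (𝒯 : DIEG.Partition O h) :
    -- the scheme is well posed
    (∀ x : DIEG.L2 O, (∃ X, DIEG.IsSolution 𝒯 f g P 𝓕 W τ x X) ∧
      ∀ X Y, DIEG.IsSolution 𝒯 f g P 𝓕 W τ x X → DIEG.IsSolution 𝒯 f g P 𝓕 W τ x Y →
        ∀ᵐ ω ∂P, ∀ m, X m ω = Y m ω) ∧
    0 < DIEG.gamma6 O L₁ L₆ ∧
    -- there is exactly one invariant measure, and it is exponentially mixing
    ∀ X : DIEG.L2 O → ℕ → Ω → DIEG.Vh 𝒯,
      (∀ x, DIEG.IsSolution 𝒯 f g P 𝓕 W τ x (X x)) →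
      ∃ π : ProbabilityMeasure (DIEG.Vh 𝒯),
        DIEG.IsInvariant P X π ∧ (∀ π', DIEG.IsInvariant P X π' → π' = π) ∧
        ∀ x : DIEG.L2 O,
          Integrable (fun y : DIEG.Vh 𝒯 => ‖x - (y : DIEG.L2 O)‖) (π : Measure (DIEG.Vh 𝒯)) ∧
          ∀ (m : ℕ) (φ : DIEG.L2 O → ℝ), DIEG.IsLipB φ →
            |DIEG.semigroup P X m (fun y => φ y) x -
                ∫ y : DIEG.Vh 𝒯, φ y ∂(π : Measure (DIEG.Vh 𝒯))| ≤
              Real.exp (-DIEG.gamma6 O L₁ L₆ * (m * τ) / 2) * DIEG.lipNorm φ *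
                ∫ y : DIEG.Vh 𝒯, ‖x - (y : DIEG.L2 O)‖ ∂(π : Measure (DIEG.Vh 𝒯)) := by
  have hL₆ := hg.nonneg₆
  have ha' : L₁ + L₆ / 2 < DIEG.firstEigenvalue O := (le_max_left _ _).trans_lt hL
  have ha : 0 < DIEG.firstEigenvalue O - L₁ := by linarith
  have haL : L₆ < 2 * (DIEG.firstEigenvalue O - L₁) := by linarith
  have hτ₀' : (0 : ℝ) < τ := hτ₀
  have hτ₁' : (τ : ℝ) < 1 := hτ₁
  have hγ : 0 < DIEG.gamma6 O L₁ L₆ := div_pos (by linarith) (by linarith)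
  have hex := hg.exists_lipschitz hOb hQ.pos
  have hK := hex.choose_spec
  -- The coercivity constant of `-A_h` is `λ₁` and the one-sided constant of the drift is `L₁`,
  -- whence `c = 1 + τ (λ₁ - L₁)`.
  have hres := DIEG.exists_resolvent (A := DIEG.Ah 𝒯)
    (F := fun y => DIEG.Ph 𝒯 (DIEG.toHm1 O fun ξ => f ((y : DIEG.L2 O) ξ)))
    τ.coe_nonneg (by linarith) (DIEG.inner_Ah_self_le 𝒯) (DIEG.inner_drift_sub_le 𝒯 hOb hf)
    (DIEG.drift_lipschitzOn 𝒯 hOb hf)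
  have hS := hres.choose_spec
  have hnoise := DIEG.exists_noise 𝒯 hOb hK
  have hN := hnoise.choose_spec
  have hc : 0 < 1 + (τ : ℝ) * (DIEG.firstEigenvalue O - L₁) := by positivity
  exact ⟨DIEG.exists_unique_solution hW hS.1 hN.1
      (DIEG.continuous_of_expansive_inverse hc hS.2) hN.2, hγ,
    fun X hX => DIEG.exists_mixing_invariant hOb hQ hg hK hW hS.1 hN.1 hN.2 hc hS.2 hγ hτ₀
      (DIEG.contraction_rate_le ha haL hτ₀' hτ₁') hX⟩
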